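/- Let $k$ be an algebraically closed field, $\Phi$ a finite dimensional $k$-algebra and $d\geqslant 1$ an integer. Write $\operatorname{mod}(\Phi)$ for the category of finitely generated right $\Phi$-modules. **Definitions.** A full subcategory $\mathscr F\subseteq\operatorname{mod}(\Phi)$ is *$d$-cluster tilting* if it is functorially finite (each $m\in\operatorname{mod}(\Phi)$ has a morphism $m\to f$ with $f\in\mathscr F$ through which every morphism from $m$ to an object of $\mathscr F$ factors, and dually) and $$\mathscr F=\{f\mid \operatorname{Ext}^i_\Phi(\mathscr F,f)=0\text{ for }1\leqslant i\leqslant d-1\}=\{f\mid \operatorname{Ext}^i_\Phi(f,\mathscr F)=0\text{ for }1\leqslant i\leqslant d-1\},$$ where $f$ ranges over $\operatorname{mod}(\Phi)$. The pair $(\Phi,\mathscr F)$ is then called a *$d$-homological pair*. In an additive category $\mathscr M$, a *$d$-kernel* of $m_1\to m_0$ is a diagram $m_{d+1}\to\cdots\to m_1$ such that $0\to\mathscr M(m,m_{d+1})\to\cdots\to\mathscr M(m,m_1)\to\mathscr M(m,m_0)$ is exact for each $m\in\mathscr M$; *$d$-cokernels* are defined dually; $m_{d+1}\to\cdots\to m_0$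 is *$d$-exact* if $m_{d+1}\to\cdots\to m_1$ is a $d$-kernel of $m_1\to m_0$ and $m_d\to\cdots\to m_0$ is a $d$-cokernel of $m_{d+1}\to m_d$. Two $d$-exact sequences with the same end terms are *Yoneda equivalent* if they are related by the equivalence relation generated by morphisms of $d$-exact sequences that are the identity on both end terms. A full subcategory $\mathscr W\subseteq\mathscr M$ is *wide* in $\mathscr M$ if it is closed under isomorphisms, finite direct sums and direct summands; each morphism in $\mathscr W$ has a $d$-kernel and a $d$-cokernel in $\mathscr M$ consisting of objects of $\mathscr W$; and each $d$-exact sequence $0\to w'\to m_d\to\cdots\to m_1\to w''\to 0$ in $\mathscr M$ with $w',w''\in\mathscr W$ is Yoneda equivalent to a $d$-exact sequence $0\to w'\to w_d\to\cdots\to w_1\to w''\to 0$ in $\mathscr M$ with all $w_i\in\mathscr W$. Finally, $\operatorname{add}(s)$ consists of the direct summands of finite direct sums of copies of $s$. **Theorem B.** Let $(\Phi,\mathscr F)$ be a $d$-homological pair, $\mathscr W\subseteq\mathscr F$ a full subcategory closed under isomorphisms in $\mathscr F$, and $s\in\mathscr W$. Set $\Gamma=\operatorname{End}_\Phi(s)$,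 so that $s$ is a $\Gamma$-$\Phi$-bimodule. Assume: 1. $\operatorname{projdim}(s_\Phi)<\infty$; 2. $\operatorname{Ext}^i_\Phi(s,s)=0$ for all $i\geqslant 1$; 3. for each $w\in\mathscr W$ there is, for some $m\geqslant 0$, an exact sequence $0\to p_m\to\cdots\to p_1\to p_0\to w\to 0$ in $\operatorname{mod}(\Phi)$ with all $p_i\in\operatorname{add}(s)$; 4. $\mathscr G:=\operatorname{Hom}_\Phi(s,\mathscr W)$, the full subcategory of the right $\Gamma$-modules isomorphic to $\operatorname{Hom}_\Phi(s,w)$ for some $w\in\mathscr W$, is $d$-cluster tilting in $\operatorname{mod}(\Gamma)$. Then $\mathscr W$ is a wide subcategory of $\mathscr F$, and the functor $-\otimes_\Gamma s$ restricts to an equivalence of categories $\mathscr G\to\mathscr W$. -/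

import Mathlib

open CategoryTheory CategoryTheory.Limits
open scoped TensorProduct MulOpposite

universe u

/-! Conventions: a full subcategory is given by a predicate on objects (`ObjectProperty`). For a
ring `A`, right `A`-modules are modules over `Aᵐᵒᵖ`, where `MulOpposite.op a` acts as right
multiplication by `a`, so `Mod A` is `ModuleCat Aᵐᵒᵖ`, and `mod A` is given by
`ModuleCat.isFG Aᵐᵒᵖ`. -/

namespace HigherWide

section Category

variable {C : Type*} [Category* C]

/-- Each object of the full subcategory `M` has a `W`-preenvelope. -/
def IsPreenvelopingIn (W M : ObjectProperty C) : Prop :=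
  ∀ m : C, M m → ∃ (w : C) (_ : W w) (φ : m ⟶ w),
    ∀ (w' : C), W w' → ∀ f : m ⟶ w', ∃ g : w ⟶ w', φ ≫ g = f

/-- Each object of the full subcategory `M` has a `W`-precover. -/
def IsPrecoveringIn (W M : ObjectProperty C) : Prop :=
  ∀ m : C, M m → ∃ (w : C) (_ : W w) (φ : w ⟶ m),
    ∀ (w' : C), W w' → ∀ f : w' ⟶ m, ∃ g : w' ⟶ w, g ≫ φ = f

/-- The full subcategory `W` is functorially finite in the full subcategory `M`. -/
structure IsFunctoriallyFiniteIn (W M : ObjectProperty C) : Prop where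
  preenveloping : IsPreenvelopingIn W M
  precovering : IsPrecoveringIn W M

end Category

section DExact

variable {M : Type*} [Category* M] [Preadditive M] {d : ℕ}

/-- A diagram `m_{d+1} ⟶ ⋯ ⟶ m_1 ⟶ m_0` (so `S.obj i` is `m_{d+1-i}`) such that
`0 → M(m, m_{d+1}) → ⋯ → M(m, m_1) → M(m, m_0)` is exact for each `m`, that is,
`m_{d+1} ⟶ ⋯ ⟶ m_1` is a `d`-kernel of `m_1 ⟶ m_0`. -/
structure IsDKernel (S : ComposableArrows M (d + 1)) : Prop where
  injective (m : M) : Function.Injective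
    (fun f : m ⟶ S.obj' 0 => f ≫ S.map' 0 1)
  exact (m : M) (i : ℕ) (hi : i + 2 ≤ d + 1) : Function.Exact
    (fun f : m ⟶ S.obj' i => f ≫ S.map' i (i + 1))
    (fun f : m ⟶ S.obj' (i + 1) => f ≫ S.map' (i + 1) (i + 2))

/-- A diagram `m_{d+1} ⟶ m_d ⟶ ⋯ ⟶ m_0` such that
`0 → M(m_0, m) → ⋯ → M(m_d, m) → M(m_{d+1}, m)` is exact for each `m`, that is,
`m_d ⟶ ⋯ ⟶ m_0` is a `d`-cokernel of `m_{d+1} ⟶ m_d`. -/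
structure IsDCokernel (S : ComposableArrows M (d + 1)) : Prop where
  injective (m : M) : Function.Injective
    (fun f : S.obj' (d + 1) ⟶ m => S.map' d (d + 1) ≫ f)
  exact (m : M) (i : ℕ) (hi : i + 2 ≤ d + 1) : Function.Exact
    (fun f : S.obj' (i + 2) ⟶ m => S.map' (i + 1) (i + 2) ≫ f)
    (fun f : S.obj' (i + 1) ⟶ m => S.map' i (i + 1) ≫ f)

/-- A `d`-exact sequence. -/
structure IsDExact (S : ComposableArrows M (d + 1)) : Prop where
  isDKernel : IsDKernel S
  isDCokernel : IsDCokernel S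

variable (d) in
/-- A `d`-exact sequence `0 → A → m_d → ⋯ → m_1 → B → 0`. -/
structure DExtension (A B : M) where
  seq : ComposableArrows M (d + 1)
  isDExact : IsDExact seq
  isoLeft : seq.obj' 0 ≅ A
  isoRight : seq.obj' (d + 1) ≅ B

/-- There is a morphism of `d`-exact sequences from `S` to `T` which is the identity on both
end terms `A` and `B`. -/
def DExtension.HasMorphism {A B : M} (S T : DExtension d A B) : Prop :=
  ∃ φ : S.seq ⟶ T.seq,
    ComposableArrows.app' φ 0 ≫ T.isoLeft.hom = S.isoLeft.hom ∧
    ComposableArrows.app' φ (d + 1) ≫ T.isoRight.hom = S.isoRight.hom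

/-- Yoneda equivalence of `d`-exact sequences: the equivalence relation generated by the
morphisms which are the identity on the end terms. -/
def DExtension.YonedaEquiv {A B : M} (S T : DExtension d A B) : Prop :=
  Relation.EqvGen DExtension.HasMorphism S T

/-- A full subcategory closed under isomorphisms, (finite) direct sums and direct summands. -/
structure IsAdditiveSubcategory (W : ObjectProperty M) : Prop where
  isClosedUnderIsomorphisms : W.IsClosedUnderIsomorphisms
  containsZero : W.ContainsZero
  directSum (X Y : M) : W X → W Y → ∃ b : BinaryBicone X Y, Nonempty b.IsBilimit ∧ W b.pt
  summand (X Y : M) : Retract X Y → W Y → W X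

variable (d) in
/-- Wide subcategories of a (`d`-abelian) category `M`. -/
structure IsWide (W : ObjectProperty M) : Prop extends IsAdditiveSubcategory W where
  dKernel {X Y : M} (f : X ⟶ Y) : W X → W Y →
    ∃ S : ComposableArrows M (d + 1), IsDKernel S ∧ (∀ i, W (S.obj i)) ∧
      Nonempty (Arrow.mk (S.map' d (d + 1)) ≅ Arrow.mk f)
  dCokernel {X Y : M} (f : X ⟶ Y) : W X → W Y →
    ∃ S : ComposableArrows M (d + 1), IsDCokernel S ∧ (∀ i, W (S.obj i)) ∧
      Nonempty (Arrow.mk (S.map' 0 1) ≅ Arrow.mk f)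
  dExtension {A B : M} (S : DExtension d A B) : W A → W B →
    ∃ T : DExtension d A B, (∀ i, W (T.seq.obj i)) ∧ DExtension.YonedaEquiv S T

end DExact

section ClusterTilting

variable {R : Type u} [Ring R]

/-- `d`-cluster tilting subcategories of the category of finitely generated `R`-modules. -/
structure IsDClusterTilting (d : ℕ) (F : ObjectProperty (ModuleCat.{u} R)) : Prop where
  le_isFG : F ≤ ModuleCat.isFG R
  functoriallyFinite : IsFunctoriallyFiniteIn F (ModuleCat.isFG R)
  iff_right (f : ModuleCat.{u} R) : ModuleCat.isFG R f →
    (F f ↔ ∀ x, F x → ∀ i, 1 ≤ i → i < d → Subsingleton (Abelian.Ext x f i))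
  iff_left (f : ModuleCat.{u} R) : ModuleCat.isFG R f →
    (F f ↔ ∀ x, F x → ∀ i, 1 ≤ i → i < d → Subsingleton (Abelian.Ext f x i))

/-- The subcategory `add(s)`: the direct summands of finite direct sums of copies of `s`. -/
def addSubcategory (s : ModuleCat.{u} R) : ObjectProperty (ModuleCat.{u} R) :=
  fun p => ∃ n : ℕ, Nonempty (Retract p (ModuleCat.of R (Fin n → s)))

/-- There is an exact sequence `0 → p_m → ⋯ → p_1 → p_0 → w → 0` with all `p_i` in `P`. -/
def HasFiniteResolution (P : ObjectProperty (ModuleCat.{u} R)) (w : ModuleCat.{u} R) : Prop :=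
  ∃ (m : ℕ) (S : ComposableArrows (ModuleCat.{u} R) (m + 1)),
    S.Exact ∧ Mono (S.map' 0 1) ∧ Epi (S.map' m (m + 1)) ∧
    (∀ (i : ℕ) (hi : i ≤ m), P (S.obj' i)) ∧ Nonempty (S.obj' (m + 1) ≅ w)

end ClusterTilting

/-! For a ring `Γ`, a ring `R` (below: `R = Φᵐᵒᵖ`) and a module `s` with commuting left actions
of `Γ` and `R` (below: a `Γ`-`Φ`-bimodule), the functors `Hom_R(s, -)` to right `Γ`-modules and
`- ⊗_Γ s` to `R`-modules. -/

section Bimodule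

/-- The abelian group `Hom_R(s, N)`, to be regarded as a right `Γ`-module. -/
@[nolint unusedArguments]
def HomModule (_Γ R : Type u) [Ring R] (s : Type u) [AddCommGroup s] [Module R s]
    (N : Type u) [AddCommGroup N] [Module R N] : Type u := s →ₗ[R] N

variable (Γ R : Type u) [Ring Γ] [Ring R]
variable (s : Type u) [AddCommGroup s] [Module Γ s] [Module R s] [SMulCommClass Γ R s]

instance (N : Type u) [AddCommGroup N] [Module R N] : AddCommGroup (HomModule Γ R s N) :=
  inferInstanceAs (AddCommGroup (s →ₗ[R] N))

instance (N : Type u) [AddCommGroup N] [Module R N] : FunLike (HomModule Γ R s N) s N :=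
  inferInstanceAs (FunLike (s →ₗ[R] N) s N)

instance (N : Type u) [AddCommGroup N] [Module R N] : LinearMapClass (HomModule Γ R s N) R s N :=
  inferInstanceAs (LinearMapClass (s →ₗ[R] N) R s N)

/-- The right `Γ`-module structure on `Hom_R(s, N)`, given by `(f · γ)(x) = f (γ x)`. -/
instance (N : Type u) [AddCommGroup N] [Module R N] : Module Γᵐᵒᵖ (HomModule Γ R s N) where
  smul γ f :=
    { toFun := fun x => f (γ.unop • x)
      map_add' := fun x y => by rw [smul_add, map_add]
      map_smul' := fun r x => by rw [smul_comm, map_smul, RingHom.id_apply] }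
  one_smul f := LinearMap.ext fun x => congrArg f (one_smul Γ x)
  mul_smul a b f := LinearMap.ext fun x => congrArg f (mul_smul b.unop a.unop x)
  smul_zero _ := LinearMap.ext fun _ => rfl
  smul_add _ _ _ := LinearMap.ext fun _ => rfl
  add_smul a b f := LinearMap.ext fun x =>
    (congrArg f (add_smul a.unop b.unop x)).trans (map_add f _ _)
  zero_smul f := LinearMap.ext fun x => (congrArg f (zero_smul Γ x)).trans (map_zero f)

/-- The functor `Hom_R(s, -)` from `R`-modules to right `Γ`-modules. -/
def homFunctor : ModuleCat.{u} R ⥤ ModuleCat.{u} Γᵐᵒᵖ where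
  obj N := ModuleCat.of Γᵐᵒᵖ (HomModule Γ R s N)
  map {N N'} g := ModuleCat.ofHom
    { toFun := fun f : s →ₗ[R] N => (g.hom.comp f : s →ₗ[R] N')
      map_add' := fun _ _ => LinearMap.comp_add _ _ _
      map_smul' := fun _ _ => LinearMap.ext fun _ => rfl }

/-- The relations `(γ x) ⊗ m = x ⊗ (m γ)` inside `s ⊗_ℤ m`. -/
def balancedRelations (N : Type u) [AddCommGroup N] [Module Γᵐᵒᵖ N] :
    Submodule R (s ⊗[ℤ] N) :=
  Submodule.span R {t | ∃ (γ : Γ) (x : s) (n : N),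
    t = (γ • x) ⊗ₜ[ℤ] n - x ⊗ₜ[ℤ] (MulOpposite.op γ • n)}

/-- The tensor product `N ⊗_Γ s` of a right `Γ`-module `N` and the left `Γ`-module `s`, with its
`R`-action coming from `s`. It is the quotient of the tensor product over `ℤ` by the
`Γ`-balancing relations; the factors are written in the order `s`, `N`. -/
abbrev BalancedTensor (N : Type u) [AddCommGroup N] [Module Γᵐᵒᵖ N] : Type u :=
  (s ⊗[ℤ] N) ⧸ balancedRelations Γ R s N

/-- The map `g ⊗_Γ s` induced by a homomorphism `g` of right `Γ`-modules. -/
def BalancedTensor.map {N N' : Type u} [AddCommGroup N] [Module Γᵐᵒᵖ N]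
    [AddCommGroup N'] [Module Γᵐᵒᵖ N'] (g : N →ₗ[Γᵐᵒᵖ] N') :
    BalancedTensor Γ R s N →ₗ[R] BalancedTensor Γ R s N' :=
  Submodule.mapQ _ _
    (TensorProduct.AlgebraTensorModule.map (LinearMap.id : s →ₗ[R] s)
      (g.toAddMonoidHom.toIntLinearMap : N →ₗ[ℤ] N'))
    (by
      rw [balancedRelations, Submodule.span_le]
      rintro _ ⟨γ, x, n, rfl⟩
      refine Submodule.subset_span ⟨γ, x, g n, ?_⟩
      simp)

/-- The functor `- ⊗_Γ s` from right `Γ`-modules to `R`-modules. -/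
def tensorFunctor : ModuleCat.{u} Γᵐᵒᵖ ⥤ ModuleCat.{u} R where
  obj N := ModuleCat.of R (BalancedTensor Γ R s N)
  map g := ModuleCat.ofHom (BalancedTensor.map Γ R s g.hom)
  map_id N := by
    refine ModuleCat.hom_ext (LinearMap.ext fun x => ?_)
    induction x using Submodule.Quotient.induction_on with | _ x
    change Submodule.Quotient.mk _ = Submodule.Quotient.mk _
    congr 1
    induction x with
    | zero => simp
    | tmul a b => rfl
    | add a b ha hb => rw [map_add, ha, hb]
  map_comp f g := by
    refine ModuleCat.hom_ext (LinearMap.ext fun x => ?_)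
    induction x using Submodule.Quotient.induction_on with | _ x
    change Submodule.Quotient.mk _ = Submodule.Quotient.mk _
    congr 1
    induction x with
    | zero => simp
    | tmul a b => rfl
    | add a b ha hb => simp only [map_add, ha, hb]

end Bimodule

end HigherWide

/-!
Write `R = Φᵐᵒᵖ`, `Γ = End_R(s)`, `H = Hom_R(s, -)` and `T = - ⊗_Γ s`, so that `T ⊣ H`.

*The counit on `W`.* By induction along a finite resolution of `w` by `add(s)`, starting from the
evaluation isomorphism `T (H s) ≅ s`, the counit `T (H w) → w` is invertible and
`Ext^i(s, w) = 0` for `i ≥ 1` (`FinitelyResolved.isIso_counit`,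
`FinitelyResolved.subsingleton_ext`). The image under `H` of the resolution is a projective
resolution of `H w`, and hence, if both `Ext^i_R(s, X)` and `Ext^i_R(w, X)` vanish for
`1 ≤ i ≤ e`, so does `Ext^i_Γ(H w, H X)` (`FinitelyResolved.subsingleton_ext_homFunctor`).

*Exactness of `T`.* Let `I` be an injective `R`-module. The last fact, with `X = I` and `e`
arbitrary, shows that objects of `G = H W` have no higher extensions into `H I`. Every finitely
generated `Γ`-module has a finite coresolution in the `d`-cluster tilting subcategory `G`, so it has
no higher extensions into `H I` either, and Baer's criterion shows that `H I` is injective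
(`injective_endHom_obj`). As its right adjoint preserves injectives, `T` is exact
(`preservesHomology_endTensor`).

*`H` maps `F` into `G`.* The same fact with `X = m` in `F` and `e = d - 1` gives
`Ext^i_Γ(G, H m) = 0` for `1 ≤ i < d`, so `H m` lies in `G` because `G` is `d`-cluster tilting
(`prop_endHom_obj`), and `T (H m)` lies in `W`.

*Wideness.* An exact sequence with terms in a `d`-cluster tilting subcategory is a `d`-kernel if it
starts with a monomorphism and a `d`-cokernel if it ends with an epimorphism
(`IsDClusterTilting.isDKernel_lift`, `IsDClusterTilting.isDCokernel_lift`). For a morphism `f` of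
`W`, one therefore extends `H f` to an exact sequence in `G` by approximations and applies the exact
functor `T`. A `d`-exact sequence `S` in `F` is exact as a sequence of modules, because `F` contains
`R` and enough injectives. If its ends lie in `W`, then `H S` is exact, including at the right
end since `Ext^d(s, -)` vanishes on the left end. So `T (H S)` is a `d`-exact sequence in `W`, and
the counit is a morphism `T (H S) → S` that is invertible at both ends (`exists_dExtension`).
-/

namespace HigherWide

/-! ### Vanishing of `Ext` along short exact sequences -/

section Ext

universe w' v' u'

open Abelian

variable {C : Type u'} [Category.{v'} C] [Abelian C] [HasExt.{w'} C] {S : ShortComplex C}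

lemma subsingleton_ext_X₃_right (hS : S.ShortExact) (X : C) {n : ℕ}
    (h₂ : Subsingleton (Ext X S.X₂ n)) (h₁ : Subsingleton (Ext X S.X₁ (n + 1))) :
    Subsingleton (Ext X S.X₃ n) := by
  refine subsingleton_of_forall_eq 0 fun x => ?_
  obtain ⟨y, rfl⟩ := Ext.covariant_sequence_exact₃ X hS x rfl (Subsingleton.elim _ _)
  rw [Subsingleton.elim y 0, Ext.zero_comp]

lemma subsingleton_ext_X₁_right (hS : S.ShortExact) (X : C) {n : ℕ}
    (h₃ : Subsingleton (Ext X S.X₃ n)) (h₂ : Subsingleton (Ext X S.X₂ (n + 1))) :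
    Subsingleton (Ext X S.X₁ (n + 1)) := by
  refine subsingleton_of_forall_eq 0 fun x => ?_
  obtain ⟨y, rfl⟩ := Ext.covariant_sequence_exact₁ X hS x (Subsingleton.elim _ _) rfl
  rw [Subsingleton.elim y 0, Ext.zero_comp]

lemma subsingleton_ext_X₁_left (hS : S.ShortExact) (Y : C) {n : ℕ}
    (h₂ : Subsingleton (Ext S.X₂ Y n)) (h₃ : Subsingleton (Ext S.X₃ Y (n + 1))) :
    Subsingleton (Ext S.X₁ Y n) := by
  refine subsingleton_of_forall_eq 0 fun x => ?_
  obtain ⟨y, rfl⟩ := Ext.contravariant_sequence_exact₁ hS Y x (add_comm 1 n)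
    (Subsingleton.elim _ _)
  rw [Subsingleton.elim y 0, Ext.comp_zero]

lemma subsingleton_ext_X₃_left (hS : S.ShortExact) (Y : C) {n : ℕ}
    (h₁ : Subsingleton (Ext S.X₁ Y n)) (h₂ : Subsingleton (Ext S.X₂ Y (n + 1))) :
    Subsingleton (Ext S.X₃ Y (n + 1)) := by
  refine subsingleton_of_forall_eq 0 fun x => ?_
  obtain ⟨y, rfl⟩ := Ext.contravariant_sequence_exact₃ hS Y x (Subsingleton.elim _ _)
    (add_comm 1 n)
  rw [Subsingleton.elim y 0, Ext.comp_zero]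

lemma exists_lift_of_subsingleton_ext (hS : S.ShortExact) {X : C}
    (h : Subsingleton (Ext X S.X₁ 1)) (f : X ⟶ S.X₃) : ∃ g : X ⟶ S.X₂, g ≫ S.g = f := by
  obtain ⟨y, hy⟩ := Ext.covariant_sequence_exact₃ X hS (Ext.mk₀ f) (zero_add 1)
    (Subsingleton.elim _ _)
  obtain ⟨g, rfl⟩ := (Ext.mk₀_bijective _ _).2 y
  rw [Ext.mk₀_comp_mk₀] at hy
  exact ⟨g, (Ext.mk₀_bijective _ _).1 hy⟩

lemma exists_extension_of_subsingleton_ext (hS : S.ShortExact) {Y : C}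
    (h : Subsingleton (Ext S.X₃ Y 1)) (f : S.X₁ ⟶ Y) : ∃ g : S.X₂ ⟶ Y, S.f ≫ g = f := by
  obtain ⟨y, hy⟩ := Ext.contravariant_sequence_exact₁ hS Y (Ext.mk₀ f) (add_zero 1)
    (Subsingleton.elim _ _)
  obtain ⟨g, rfl⟩ := (Ext.mk₀_bijective _ _).2 y
  rw [Ext.mk₀_comp_mk₀] at hy
  exact ⟨g, (Ext.mk₀_bijective _ _).1 hy⟩

/-- In degree one, lifting of morphisms replaces the vanishing of `Ext^0(X, S.X₃)` in dimension
shifting. -/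
lemma subsingleton_ext_one_X₁_right (hS : S.ShortExact) {X : C}
    (hl : ∀ f : X ⟶ S.X₃, ∃ g : X ⟶ S.X₂, g ≫ S.g = f)
    (h₂ : Subsingleton (Ext X S.X₂ 1)) : Subsingleton (Ext X S.X₁ 1) := by
  refine subsingleton_of_forall_eq 0 fun x => ?_
  obtain ⟨y, rfl⟩ := Ext.covariant_sequence_exact₁ X hS x (Subsingleton.elim _ _) (zero_add 1)
  obtain ⟨f, rfl⟩ := (Ext.mk₀_bijective _ _).2 y
  obtain ⟨g, rfl⟩ := hl f
  rw [← Ext.mk₀_comp_mk₀, Ext.comp_assoc _ _ _ _ (zero_add 1) (by lia), hS.comp_extClass,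
    Ext.comp_zero]

lemma subsingleton_ext_one_X₃_left (hS : S.ShortExact) {Y : C}
    (he : ∀ f : S.X₁ ⟶ Y, ∃ g : S.X₂ ⟶ Y, S.f ≫ g = f)
    (h₂ : Subsingleton (Ext S.X₂ Y 1)) : Subsingleton (Ext S.X₃ Y 1) := by
  refine subsingleton_of_forall_eq 0 fun x => ?_
  obtain ⟨y, rfl⟩ := Ext.contravariant_sequence_exact₃ hS Y x (Subsingleton.elim _ _) (add_zero 1)
  obtain ⟨f, rfl⟩ := (Ext.mk₀_bijective _ _).2 y
  obtain ⟨g, rfl⟩ := he f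
  rw [← Ext.mk₀_comp_mk₀, ← Ext.comp_assoc _ _ _ (add_zero 1) _ (by lia), hS.extClass_comp,
    Ext.zero_comp]

/-- `Ext` vanishes at an object whose identity is a sum of endomorphisms factoring through an
object at which `Ext` vanishes. -/
lemma subsingleton_ext_right_of_sum {X Y : C} {ι : Type*} [Fintype ι] {f : ι → (X ⟶ Y)}
    {g : ι → (Y ⟶ X)} (h : ∑ i, f i ≫ g i = 𝟙 X) (A : C) (n : ℕ)
    (hY : Subsingleton (Ext A Y n)) : Subsingleton (Ext A X n) := by
  refine subsingleton_of_forall_eq 0 fun x => ?_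
  rw [← Ext.comp_mk₀_id x, ← h, Ext.mk₀_sum, Ext.comp_sum]
  refine Finset.sum_eq_zero fun i _ => ?_
  rw [← Ext.mk₀_comp_mk₀, ← Ext.comp_assoc _ _ _ (add_zero n) _ (by lia),
    Subsingleton.elim (x.comp (Ext.mk₀ (f i)) _) 0, Ext.zero_comp]

lemma subsingleton_ext_left_of_sum {X Y : C} {ι : Type*} [Fintype ι] {f : ι → (X ⟶ Y)}
    {g : ι → (Y ⟶ X)} (h : ∑ i, f i ≫ g i = 𝟙 X) (A : C) (n : ℕ)
    (hY : Subsingleton (Ext Y A n)) : Subsingleton (Ext X A n) := by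
  refine subsingleton_of_forall_eq 0 fun x => ?_
  rw [← Ext.mk₀_id_comp x, ← h, Ext.mk₀_sum, Ext.sum_comp]
  refine Finset.sum_eq_zero fun i _ => ?_
  rw [← Ext.mk₀_comp_mk₀, Ext.comp_assoc _ _ _ _ (zero_add n) (by lia),
    Subsingleton.elim ((Ext.mk₀ (g i)).comp x _) 0, Ext.comp_zero]

lemma subsingleton_ext_right_of_isZero {X : C} (hX : IsZero X) (A : C) (n : ℕ) :
    Subsingleton (Ext A X n) := by
  refine subsingleton_of_forall_eq 0 fun x => ?_
  rw [← Ext.comp_mk₀_id x, hX.eq_zero_of_src (𝟙 X), Ext.mk₀_zero, Ext.comp_zero]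

end Ext

/-! ### Exact sequences cut into short exact ones -/

section Exact

universe w' v' u'

open Abelian

variable {C : Type u'} [Category.{v'} C] [Abelian C] {n : ℕ} {S : ComposableArrows C n}

lemma exact_kernel_lift {X Y Z : C} {f : X ⟶ Y} {g : Y ⟶ Z} (w : f ≫ g = 0)
    (h : (ShortComplex.mk f g w).Exact) :
    (ShortComplex.mk (kernel.ι f) (kernel.lift g f w)
      (by rw [← cancel_mono (kernel.ι g)]; simp)).ShortExact where
  exact := by
    refine ShortComplex.exact_of_f_is_kernel _ (KernelFork.IsLimit.ofι' _ _ fun {A} k hk => ?_)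
    have hk' : k ≫ f = 0 := by
      have := congrArg (· ≫ kernel.ι g) hk
      simpa using this
    exact ⟨kernel.lift f k hk', by simp⟩
  mono_f := inferInstanceAs (Mono (kernel.ι f))
  epi_g := h.epi_kernelLift

/-- Successive kernels `K_j` of an exact sequence are linked by `0 → K_j → S_j → K_{j+1} → 0`. -/
lemma shortExact_kernel_lift (hS : S.Exact) (j : ℕ) (hj : j + 2 ≤ n) :
    (ShortComplex.mk (kernel.ι (S.map' j (j + 1)))
      (kernel.lift (S.map' (j + 1) (j + 2)) (S.map' j (j + 1)) (hS.zero j))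
      (by rw [← cancel_mono (kernel.ι (S.map' (j + 1) (j + 2)))]; simp)).ShortExact :=
  exact_kernel_lift _ (hS.exact j)

lemma shortExact_kernel_of_epi {X Y : C} (f : X ⟶ Y) (hf : Epi f) :
    (ShortComplex.mk (kernel.ι f) f (kernel.condition f)).ShortExact where
  exact := ShortComplex.exact_kernel f
  mono_f := inferInstanceAs (Mono (kernel.ι f))
  epi_g := hf

variable [HasExt.{w'} C]

/-- Dimension shifting: if `Ext^i(m, -)` vanishes on the terms of an exact sequence for
`1 ≤ i < d` and on its left kernel for `1 ≤ i ≤ d`, it vanishes on the `j`-th kernel for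
`1 ≤ i ≤ d - j`. -/
lemma subsingleton_ext_kernel (hS : S.Exact) (m : C) (d : ℕ)
    (hm : ∀ (j : ℕ) (hj : j + 1 ≤ n) (i : ℕ), 1 ≤ i → i < d → Subsingleton (Ext m (S.obj' j) i))
    (h0 : ∀ (h : 1 ≤ n) (i : ℕ), 1 ≤ i → i ≤ d →
      Subsingleton (Ext m (kernel (S.map' 0 1)) i)) :
    ∀ (j : ℕ) (hj : j + 1 ≤ n) (i : ℕ), 1 ≤ i → i + j ≤ d →
      Subsingleton (Ext m (kernel (S.map' j (j + 1))) i) := by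
  intro j
  induction j with
  | zero => exact fun hj i h1 h2 => h0 hj i h1 h2
  | succ j ih =>
    intro hj i h1 h2
    exact subsingleton_ext_X₃_right (shortExact_kernel_lift hS j hj) m
      (hm j (by lia) i h1 (by lia)) (ih (by lia) (i + 1) (by lia) (by lia))

/-- An exact sequence is `Hom(m, -)`-exact at a term as soon as `Ext^1(m, -)` vanishes on the
kernel one step to the left. -/
lemma exists_lift_of_exact (hS : S.Exact) {m : C} (i : ℕ) (hi : i + 2 ≤ n)
    (h : Subsingleton (Ext m (kernel (S.map' i (i + 1))) 1)) (f : m ⟶ S.obj' (i + 1))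
    (hf : f ≫ S.map' (i + 1) (i + 2) = 0) : ∃ g : m ⟶ S.obj' i, g ≫ S.map' i (i + 1) = f := by
  obtain ⟨g, hg⟩ := exists_lift_of_subsingleton_ext (shortExact_kernel_lift hS i hi) h
    (kernel.lift _ f hf)
  refine ⟨g, ?_⟩
  have := congrArg (· ≫ kernel.ι (S.map' (i + 1) (i + 2))) hg
  simpa using this

/-- Dual dimension shifting, for an exact sequence ending with an epimorphism. -/
lemma subsingleton_ext_kernel_left {n : ℕ} {S : ComposableArrows C (n + 1)} (hS : S.Exact)
    (hepi : Epi (S.map' n (n + 1))) (m : C) (d : ℕ)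
    (hm : ∀ (j : ℕ) (hj : j ≤ n + 1) (i : ℕ), 1 ≤ i → i < d →
      Subsingleton (Ext (S.obj' j) m i)) :
    ∀ (k j : ℕ) (hj : j + k = n) (i : ℕ), 1 ≤ i → i + k + 1 < d →
      Subsingleton (Ext (kernel (S.map' j (j + 1))) m i) := by
  intro k
  induction k with
  | zero =>
    intro j hj i h1 h2
    obtain rfl : j = n := by lia
    have hK := shortExact_kernel_of_epi _ hepi
    exact subsingleton_ext_X₁_left hK m
      (hm j (by lia) i h1 (by lia)) (hm (j + 1) (by lia) (i + 1) (by lia) (by lia))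
  | succ k ih =>
    intro j hj i h1 h2
    exact subsingleton_ext_X₁_left (shortExact_kernel_lift hS j (by lia)) m
      (hm j (by lia) i h1 (by lia)) (ih (j + 1) (by lia) (i + 1) (by lia) (by lia))

/-- A morphism `S_{i+1} ⟶ m` that vanishes on `S_i` extends along `S_{i+1} ⟶ S_{i+2}` if
`Ext^i(S_j, m) = 0` for `1 ≤ i < d`. -/
lemma exists_extension_of_exact {d : ℕ} {S : ComposableArrows C (d + 1)} (hS : S.Exact)
    (hepi : Epi (S.map' d (d + 1))) {m : C}
    (hm : ∀ (j : ℕ) (hj : j ≤ d + 1) (i : ℕ), 1 ≤ i → i < d → Subsingleton (Ext (S.obj' j) m i))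
    (i : ℕ) (hi : i + 2 ≤ d + 1) (f : S.obj' (i + 1) ⟶ m) (hf : S.map' i (i + 1) ≫ f = 0) :
    ∃ g : S.obj' (i + 2) ⟶ m, S.map' (i + 1) (i + 2) ≫ g = f := by
  obtain h | h : i + 2 = d + 1 ∨ i + 3 ≤ d + 1 := by lia
  · obtain rfl : d = i + 1 := by lia
    have : Epi (S.sc hS.toIsComplex i).g := hepi
    exact ⟨(hS.exact i hi).desc f hf, (hS.exact i hi).g_desc f hf⟩
  · have hK := shortExact_kernel_lift hS (i + 1) h
    have hfac : kernel.ι (S.map' (i + 1) (i + 2)) ≫ f = 0 := by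
      have := (shortExact_kernel_lift hS i hi).epi_g
      dsimp at this
      rw [← cancel_epi (kernel.lift (S.map' (i + 1) (i + 2)) (S.map' i (i + 1)) (hS.zero i))]
      simpa using hf
    have := hK.epi_g
    -- the morphism factors through the kernel at the next place, from where it extends
    obtain ⟨k, hk⟩ : ∃ k, kernel.lift (S.map' (i + 2) (i + 3)) (S.map' (i + 1) (i + 2))
        (hS.zero (i + 1)) ≫ k = f := ⟨hK.exact.desc f hfac, hK.exact.g_desc f hfac⟩
    obtain h' | h' : i + 3 = d + 1 ∨ i + 4 ≤ d + 1 := by lia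
    · obtain rfl : d = i + 2 := by lia
      have hK' := shortExact_kernel_of_epi _ hepi
      obtain ⟨g, hg⟩ := exists_extension_of_subsingleton_ext
        hK'
        (hm (i + 3) (by lia) 1 le_rfl (by lia)) k
      refine ⟨g, ?_⟩
      dsimp at hg
      rw [← hk, ← hg]
      simp
    · obtain ⟨g, hg⟩ := exists_extension_of_subsingleton_ext
        (shortExact_kernel_lift hS (i + 2) (by lia))
        (subsingleton_ext_kernel_left hS hepi m d hm (d - (i + 3)) (i + 3) (by lia) 1 le_rfl
          (by lia)) k
      refine ⟨g, ?_⟩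
      dsimp at hg
      rw [← hk, ← hg]
      simp

end Exact

/-! ### The adjunction between `- ⊗_Γ s` and `Hom_R(s, -)` -/

section Adjunction

variable (Γ R : Type u) [Ring Γ] [Ring R]
variable (s : Type u) [AddCommGroup s] [Module Γ s] [Module R s]

variable {Γ R s} in
/-- The class of `x ⊗ n` in the balanced tensor product. -/
def BalancedTensor.tmul {N : Type u} [AddCommGroup N] [Module Γᵐᵒᵖ N] (x : s) (n : N) :
    BalancedTensor Γ R s N :=
  Submodule.Quotient.mk (x ⊗ₜ[ℤ] n)

section

variable {Γ R s} {N : Type u} [AddCommGroup N] [Module Γᵐᵒᵖ N]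

lemma BalancedTensor.smul_tmul (γ : Γ) (x : s) (n : N) :
    (tmul (γ • x) n : BalancedTensor Γ R s N) = tmul x (MulOpposite.op γ • n) :=
  (Submodule.Quotient.eq _).2 (Submodule.subset_span ⟨γ, x, n, rfl⟩)

lemma BalancedTensor.tmul_add (x : s) (n n' : N) :
    (tmul x (n + n') : BalancedTensor Γ R s N) = tmul x n + tmul x n' :=
  congrArg Submodule.Quotient.mk (TensorProduct.tmul_add x n n')

lemma BalancedTensor.add_tmul (x y : s) (n : N) :
    (tmul (x + y) n : BalancedTensor Γ R s N) = tmul x n + tmul y n :=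
  congrArg Submodule.Quotient.mk (TensorProduct.add_tmul x y n)

lemma BalancedTensor.zero_tmul (n : N) : (tmul 0 n : BalancedTensor Γ R s N) = 0 :=
  congrArg Submodule.Quotient.mk (TensorProduct.zero_tmul s n)

lemma BalancedTensor.induction {p : BalancedTensor Γ R s N → Prop} (h0 : p 0)
    (ht : ∀ x n, p (tmul x n)) (ha : ∀ a b, p a → p b → p (a + b)) (t) : p t := by
  induction t using Submodule.Quotient.induction_on with | _ t
  induction t with
  | zero => exact h0
  | tmul x n => exact ht x n
  | add a b iha ihb => exact ha _ _ iha ihb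

variable [SMulCommClass Γ R s]

/-- The `R`-linear map on the balanced tensor product attached to a `Γ`-linear map
`N → Hom_R(s, X)`. -/
def BalancedTensor.lift {X : Type u} [AddCommGroup X] [Module R X]
    (ψ : N →ₗ[Γᵐᵒᵖ] HomModule Γ R s X) : BalancedTensor Γ R s N →ₗ[R] X :=
  Submodule.liftQ _ (TensorProduct.AlgebraTensorModule.lift
    { toFun := fun x => AddMonoidHom.toIntLinearMap
        { toFun := fun n => (ψ n : s →ₗ[R] X) x
          map_zero' := by rw [map_zero]; rfl
          map_add' := fun a b => by rw [map_add]; rfl }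
      map_add' := fun x y => LinearMap.ext fun n => LinearMap.map_add (ψ n : s →ₗ[R] X) x y
      map_smul' := fun r x => LinearMap.ext fun n =>
        LinearMap.map_smul (ψ n : s →ₗ[R] X) r x })
    (by
      rw [balancedRelations, Submodule.span_le]
      rintro _ ⟨γ, x, n, rfl⟩
      simp only [SetLike.mem_coe, LinearMap.mem_ker, map_sub, sub_eq_zero]
      change (ψ n : s →ₗ[R] X) (γ • x) = (ψ (MulOpposite.op γ • n) : s →ₗ[R] X) x
      rw [ψ.map_smul]
      rfl)

/-- The `Γ`-linear map `N → Hom_R(s, X)` attached to an `R`-linear map on the balanced tensor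
product. -/
def BalancedTensor.curry {X : Type u} [AddCommGroup X] [Module R X]
    (φ : BalancedTensor Γ R s N →ₗ[R] X) : N →ₗ[Γᵐᵒᵖ] HomModule Γ R s X where
  toFun n := ({ toFun := fun x => φ (tmul x n)
                map_add' := fun x y => by rw [add_tmul, map_add]
                map_smul' := fun r x => φ.map_smul r (tmul x n) } : s →ₗ[R] X)
  map_add' n n' := LinearMap.ext fun x => by
    change φ (tmul x (n + n')) = φ (tmul x n) + φ (tmul x n')
    rw [tmul_add, map_add]
  map_smul' γ n := LinearMap.ext fun x => (congrArg φ (smul_tmul γ.unop x n)).symm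

end

variable [SMulCommClass Γ R s]

/-- The adjunction `- ⊗_Γ s ⊣ Hom_R(s, -)`. -/
def tensorHomAdjunction : tensorFunctor Γ R s ⊣ homFunctor Γ R s :=
  Adjunction.mkOfHomEquiv
    { homEquiv := fun N X =>
        { toFun := fun φ => ModuleCat.ofHom (BalancedTensor.curry φ.hom)
          invFun := fun ψ => ModuleCat.ofHom (BalancedTensor.lift ψ.hom)
          left_inv := fun φ => ModuleCat.hom_ext (LinearMap.ext fun t => by
            induction t using BalancedTensor.induction with
            | h0 => exact (map_zero _).trans (map_zero _).symm
            | ht x n => rfl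
            | ha a b iha ihb =>
              exact ((map_add _ a b).trans (congrArg₂ (· + ·) iha ihb)).trans
                (map_add φ.hom a b).symm)
          right_inv := fun ψ => rfl }
      homEquiv_naturality_left_symm := fun {N N' X} f g =>
        ModuleCat.hom_ext (LinearMap.ext fun t => by
          induction t using BalancedTensor.induction with
          | h0 => exact (map_zero _).trans (map_zero _).symm
          | ht x n => rfl
          | ha a b iha ihb =>
            exact ((map_add _ a b).trans (congrArg₂ (· + ·) iha ihb)).trans
              (map_add _ a b).symm)
      homEquiv_naturality_right := fun f g => rfl }

instance : (homFunctor Γ R s).Additive where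
  map_add := rfl

instance : (tensorFunctor Γ R s).Additive := (tensorHomAdjunction Γ R s).left_adjoint_additive

instance : PreservesFiniteColimits (tensorFunctor Γ R s) :=
  ⟨fun _ _ _ => (tensorHomAdjunction Γ R s).leftAdjoint_preservesColimits.preservesColimitsOfShape⟩

instance : PreservesFiniteLimits (homFunctor Γ R s) :=
  ⟨fun _ _ _ => (tensorHomAdjunction Γ R s).rightAdjoint_preservesLimits.preservesLimitsOfShape⟩

end Adjunction

section Endomorphisms

variable {R : Type u} [Ring R] (s : ModuleCat.{u} R)

/-- The adjunction `- ⊗_Γ s ⊣ Hom_R(s, -)` for `Γ = End_R(s)`. -/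
abbrev endAdj : tensorFunctor (Module.End R s) R s ⊣ homFunctor (Module.End R s) R s :=
  tensorHomAdjunction (Module.End R s) R s

lemma isIso_counit_self : IsIso ((endAdj s).counit.app s) := by
  let one : HomModule (Module.End R s) R s s := (LinearMap.id : s →ₗ[R] s)
  let ev : BalancedTensor (Module.End R s) R s (HomModule (Module.End R s) R s s) →ₗ[R] s :=
    BalancedTensor.lift LinearMap.id
  -- `x ⊗ f = f x ⊗ 1`, so an element is determined by its image under evaluation
  have key : ∀ t, t = BalancedTensor.tmul (ev t) one := by
    intro t
    induction t using BalancedTensor.induction with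
    | h0 => rw [map_zero, BalancedTensor.zero_tmul]
    | ht x f => exact (BalancedTensor.smul_tmul (R := R) (show Module.End R s from f) x one).symm
    | ha a b iha ihb => rw [map_add, BalancedTensor.add_tmul, ← iha, ← ihb]
  have hev : Function.Bijective ev :=
    ⟨fun t t' h => by rw [key t, key t', h], fun x => ⟨BalancedTensor.tmul x one, rfl⟩⟩
  exact (ConcreteCategory.isIso_iff_bijective _).2 hev

lemma projective_homFunctor_self :
    Projective ((homFunctor (Module.End R s) R s).obj s) := by
  -- the right module `Hom_R(s, s)` is free of rank one
  let e : (Module.End R s)ᵐᵒᵖ ≃ₗ[(Module.End R s)ᵐᵒᵖ] HomModule (Module.End R s) R s s :=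
    { toFun := fun a => (a.unop : s →ₗ[R] s)
      invFun := fun f => MulOpposite.op (show Module.End R s from f)
      map_add' := fun _ _ => rfl
      map_smul' := fun _ _ => rfl
      left_inv := fun _ => rfl
      right_inv := fun _ => rfl }
  have : Module.Projective (Module.End R s)ᵐᵒᵖ (HomModule (Module.End R s) R s s) :=
    Module.Projective.of_equiv e
  exact (IsProjective.iff_projective (HomModule (Module.End R s) R s s)).1 this

end Endomorphisms

/-! ### Objects at which the counit of an adjunction is invertible -/

section Counit

variable {C D : Type*} [Category* C] [Category* D] {F : C ⥤ D} {G : D ⥤ C} (adj : F ⊣ G)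

/-- A right adjoint is full on morphisms out of an object at which the counit is invertible. -/
lemma exists_map_eq_of_isIso_counit {K X : D} (hK : IsIso (adj.counit.app K))
    (α : G.obj K ⟶ G.obj X) : ∃ a : K ⟶ X, G.map a = α := by
  refine ⟨inv (adj.counit.app K) ≫ (adj.homEquiv _ _).symm α, ?_⟩
  have h : G.map (inv (adj.counit.app K)) = adj.unit.app _ := by
    rw [Functor.map_inv]
    exact IsIso.inv_eq_of_inv_hom_id (adj.right_triangle_components K)
  rw [Functor.map_comp, h]
  exact (adj.homEquiv_unit _ _ _).symm.trans (Equiv.apply_symm_apply _ _)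

/-- If the counit is invertible at two terms of a short exact sequence, it is so at the cokernel,
provided the right adjoint preserves the epimorphism. -/
lemma isIso_counit_of_shortExact [Abelian C] [Abelian D] [G.Additive]
    {S : ShortComplex D} (hS : S.ShortExact) (hGg : Epi (G.map S.g))
    (h₁ : IsIso (adj.counit.app S.X₁)) (h₂ : IsIso (adj.counit.app S.X₂)) :
    IsIso (adj.counit.app S.X₃) := by
  have hg := hS.epi_g
  have := adj.isLeftAdjoint
  -- the rows are right exact, so the inverse is induced on cokernels
  have hw : S.f ≫ inv (adj.counit.app S.X₂) ≫ F.map (G.map S.g) = 0 := by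
    have h1 : S.f ≫ inv (adj.counit.app S.X₂) =
        inv (adj.counit.app S.X₁) ≫ F.map (G.map S.f) := by
      rw [IsIso.comp_inv_eq, Category.assoc]
      erw [adj.counit_naturality]
      rw [IsIso.inv_hom_id_assoc]
    have := adj.left_adjoint_additive
    rw [reassoc_of% h1]
    erw [← F.map_comp, ← G.map_comp]
    rw [S.zero, Functor.map_zero, Functor.map_zero]
    exact comp_zero
  refine ⟨hS.exact.desc _ hw, ?_, ?_⟩
  · have : Epi (F.map (G.map S.g)) := inferInstance
    refine (cancel_epi (F.map (G.map S.g))).1 ?_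
    refine (adj.counit_naturality_assoc S.g _).trans ?_
    erw [hS.exact.g_desc]
    simp
  · rw [← cancel_epi S.g, ← Category.assoc, hS.exact.g_desc, Category.assoc]
    erw [adj.counit_naturality]
    rw [IsIso.inv_hom_id_assoc]
    exact (Category.comp_id _).symm

lemma isIso_unit_of_iso {X : C} {Y : D} (e : G.obj Y ≅ X) (hY : IsIso (adj.counit.app Y)) :
    IsIso (adj.unit.app X) := by
  have h : IsIso (adj.unit.app (G.obj Y)) := by
    rw [(IsIso.inv_eq_of_inv_hom_id (adj.right_triangle_components Y)).symm]
    infer_instance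
  exact (NatTrans.isIso_app_iff_of_iso adj.unit e).1 h

lemma map_injective_of_isIso_unit {X Y : C} (hY : IsIso (adj.unit.app Y)) {f g : X ⟶ Y}
    (h : F.map f = F.map g) : f = g := by
  refine (IsIso.mono_of_iso (adj.unit.app Y)).right_cancellation _ _ ?_
  have hf := adj.unit_naturality f
  rw [h] at hf
  exact hf.symm.trans (adj.unit_naturality g)

lemma exists_map_eq_of_isIso_unit {X Y : C} (hY : IsIso (adj.unit.app Y))
    (α : F.obj X ⟶ F.obj Y) : ∃ f : X ⟶ Y, F.map f = α := by
  refine ⟨adj.homEquiv _ _ α ≫ inv (adj.unit.app Y), (adj.homEquiv _ _).injective ?_⟩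
  rw [adj.homEquiv_unit, adj.unit_naturality]
  exact (Category.assoc _ _ _).trans ((congrArg _ (IsIso.inv_hom_id _)).trans (Category.comp_id _))

end Counit

/-! ### Modules with a finite resolution by `add(s)` -/

section Resolved

variable {R : Type u} [Ring R] {s : ModuleCat.{u} R}

/-- The identity of a module in `add(s)` is a finite sum of endomorphisms factoring through `s`,
which is how additive constructions are transferred from `s` to `add(s)`. -/
lemma exists_sum_eq_id_of_add {p : ModuleCat.{u} R} (hp : addSubcategory s p) :
    ∃ (n : ℕ) (f : Fin n → (p ⟶ s)) (g : Fin n → (s ⟶ p)), ∑ i, f i ≫ g i = 𝟙 p := by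
  obtain ⟨n, ⟨r⟩⟩ := hp
  refine ⟨n, fun i => r.i ≫ ModuleCat.ofHom (LinearMap.proj i),
    fun i => ModuleCat.ofHom (LinearMap.single R (fun _ : Fin n => s) i) ≫ r.r, ?_⟩
  have h : ∑ i, (ModuleCat.ofHom (LinearMap.proj i) : ModuleCat.of R (Fin n → s) ⟶ s) ≫
      ModuleCat.ofHom (LinearMap.single R (fun _ : Fin n => s) i) = 𝟙 _ := by
    refine ModuleCat.hom_ext (LinearMap.ext fun x => ?_)
    rw [ModuleCat.hom_sum, LinearMap.sum_apply]
    exact LinearMap.sum_single_apply _ x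
  calc _ = r.i ≫ (∑ i, (ModuleCat.ofHom (LinearMap.proj i) :
        ModuleCat.of R (Fin n → s) ⟶ s) ≫
          ModuleCat.ofHom (LinearMap.single R (fun _ : Fin n => s) i)) ≫ r.r := by
        simp [Preadditive.sum_comp, Preadditive.comp_sum]
    _ = 𝟙 p := by rw [h, Category.id_comp, r.retract]

lemma isIso_app_of_sum {C D : Type*} [Category* C] [Category* D] [Preadditive C] [Preadditive D]
    {F G : C ⥤ D} [F.Additive] [G.Additive] (α : F ⟶ G) {X Y : C} {ι : Type*} [Fintype ι]
    {f : ι → (X ⟶ Y)} {g : ι → (Y ⟶ X)} (h : ∑ i, f i ≫ g i = 𝟙 X) [IsIso (α.app Y)] :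
    IsIso (α.app X) := by
  refine ⟨∑ i, G.map (f i) ≫ inv (α.app Y) ≫ F.map (g i), ?_, ?_⟩
  · rw [Preadditive.comp_sum]
    simp_rw [← α.naturality_assoc, IsIso.hom_inv_id_assoc, ← F.map_comp]
    rw [← F.map_sum, h, F.map_id]
  · rw [Preadditive.sum_comp]
    simp_rw [Category.assoc, α.naturality, IsIso.inv_hom_id_assoc, ← G.map_comp]
    rw [← G.map_sum, h, G.map_id]

variable (s) in
/-- The modules with a finite resolution by modules in `add(s)`, generated by taking cokernels
of monomorphisms into modules of `add(s)`. -/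
inductive FinitelyResolved : ModuleCat.{u} R → Prop
  | of_add {p : ModuleCat.{u} R} : addSubcategory s p → FinitelyResolved p
  | step {S : ShortComplex (ModuleCat.{u} R)} : S.ShortExact → FinitelyResolved S.X₁ →
      addSubcategory s S.X₂ → FinitelyResolved S.X₃

lemma FinitelyResolved.of_iso {w w' : ModuleCat.{u} R} (e : w ≅ w')
    (hw : FinitelyResolved s w) : FinitelyResolved s w' := by
  cases hw with
  | of_add h =>
    obtain ⟨n, ⟨r⟩⟩ := h
    exact .of_add ⟨n, ⟨⟨e.inv ≫ r.i, r.r ≫ e.hom, by simp⟩⟩⟩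
  | @step S hS h₁ h₂ =>
    refine FinitelyResolved.step
      (S := ShortComplex.mk S.f (S.g ≫ e.hom) (by rw [S.zero_assoc, zero_comp])) ?_ h₁ h₂
    exact ShortComplex.shortExact_of_iso
      (ShortComplex.isoMk (S₁ := S) (Iso.refl _) (Iso.refl _) e (by simp) (by simp)) hS

lemma FinitelyResolved.of_hasFiniteResolution {w : ModuleCat.{u} R}
    (hw : HasFiniteResolution (addSubcategory s) w) : FinitelyResolved s w := by
  obtain ⟨m, S, hS, hmono, hepi, hP, ⟨e⟩⟩ := hw
  have key : ∀ (j : ℕ) (hj : j ≤ m), FinitelyResolved s (kernel (S.map' j (j + 1))) := by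
    intro j
    induction j with
    | zero =>
      intro _
      have hz : IsZero (kernel (S.map' 0 1)) := isZero_kernel_of_mono _
      exact .of_add ⟨0, ⟨⟨0, 0, hz.eq_of_src _ _⟩⟩⟩
    | succ j ih =>
      intro hj
      exact .step (shortExact_kernel_lift hS j (by lia)) (ih (by lia)) (hP j (by lia))
  exact (FinitelyResolved.step (shortExact_kernel_of_epi _ hepi) (key m le_rfl)
    (hP m le_rfl)).of_iso e

lemma FinitelyResolved.subsingleton_ext
    (h_ext : ∀ i : ℕ, 1 ≤ i → Subsingleton (Abelian.Ext s s i)) {w : ModuleCat.{u} R}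
    (hw : FinitelyResolved s w) (i : ℕ) (hi : 1 ≤ i) : Subsingleton (Abelian.Ext s w i) := by
  induction hw generalizing i with
  | of_add hp =>
    obtain ⟨n, f, g, h⟩ := exists_sum_eq_id_of_add hp
    exact subsingleton_ext_right_of_sum h s i (h_ext i hi)
  | step hS h₁ h₂ ih =>
    obtain ⟨n, f, g, h⟩ := exists_sum_eq_id_of_add h₂
    exact subsingleton_ext_X₃_right hS s (subsingleton_ext_right_of_sum h s i (h_ext i hi))
      (ih (i + 1) (by lia))

lemma shortExact_map_homFunctor {S : ShortComplex (ModuleCat.{u} R)} (hS : S.ShortExact)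
    (h : Subsingleton (Abelian.Ext s S.X₁ 1)) :
    (S.map (homFunctor (Module.End R s) R s)).ShortExact := by
  have := hS.mono_f
  refine { exact := hS.exact.map_of_mono_of_preservesKernel _ hS.mono_f inferInstance,
           mono_f := inferInstanceAs (Mono ((homFunctor (Module.End R s) R s).map S.f)),
           epi_g := ?_ }
  refine (ModuleCat.epi_iff_surjective _).2 fun f => ?_
  obtain ⟨g, hg⟩ := exists_lift_of_subsingleton_ext hS h
    (ModuleCat.ofHom (show s →ₗ[R] S.X₃ from f))
  exact ⟨(g.hom : s →ₗ[R] S.X₂), congrArg ModuleCat.Hom.hom hg⟩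

lemma isIso_counit_of_add {p : ModuleCat.{u} R} (hp : addSubcategory s p) :
    IsIso ((endAdj s).counit.app p) := by
  obtain ⟨n, f, g, h⟩ := exists_sum_eq_id_of_add hp
  have := isIso_counit_self s
  exact isIso_app_of_sum (endAdj s).counit h

lemma FinitelyResolved.isIso_counit
    (h_ext : ∀ i : ℕ, 1 ≤ i → Subsingleton (Abelian.Ext s s i)) {w : ModuleCat.{u} R}
    (hw : FinitelyResolved s w) : IsIso ((endAdj s).counit.app w) := by
  induction hw with
  | of_add hp => exact isIso_counit_of_add hp
  | @step S hS h₁ h₂ ih =>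
    have := isIso_counit_of_add h₂
    have hH := shortExact_map_homFunctor hS (h₁.subsingleton_ext h_ext 1 le_rfl)
    exact isIso_counit_of_shortExact (endAdj s) hS hH.epi_g ih this

/-- `Hom_R(s, -)` carries the vanishing of `Ext(w, X)` in an initial range of degrees to
`Γ`-modules, if `w` is finitely resolved by `add(s)` and `Ext(s, X)` vanishes in that range. -/
lemma FinitelyResolved.subsingleton_ext_homFunctor
    (h_ext : ∀ i : ℕ, 1 ≤ i → Subsingleton (Abelian.Ext s s i)) {w : ModuleCat.{u} R}
    (hw : FinitelyResolved s w) (X : ModuleCat.{u} R) (e : ℕ)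
    (hs : ∀ i, 1 ≤ i → i ≤ e → Subsingleton (Abelian.Ext s X i))
    (hX : ∀ i, 1 ≤ i → i ≤ e → Subsingleton (Abelian.Ext w X i)) (i : ℕ) (h1 : 1 ≤ i)
    (h2 : i ≤ e) :
    Subsingleton (Abelian.Ext ((homFunctor (Module.End R s) R s).obj w)
      ((homFunctor (Module.End R s) R s).obj X) i) := by
  set H := homFunctor (Module.End R s) R s
  have hadd : ∀ p, addSubcategory s p → ∀ i, 1 ≤ i →
      Subsingleton (Abelian.Ext (H.obj p) (H.obj X) i) := by
    intro p hp i h1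
    obtain ⟨n, f, g, h⟩ := exists_sum_eq_id_of_add hp
    obtain ⟨j, rfl⟩ := Nat.exists_eq_add_of_le' h1
    have := projective_homFunctor_self s
    refine subsingleton_ext_left_of_sum (f := fun i => H.map (f i)) (g := fun i => H.map (g i))
      ?_ _ _ (Abelian.Ext.subsingleton_of_projective (H.obj s) _ j)
    simp_rw [← H.map_comp]
    rw [← H.map_sum, h, H.map_id]
  induction hw generalizing e i with
  | of_add hp => exact hadd _ hp i h1
  | @step S hS h₁ h₂ ih =>
    have hH := shortExact_map_homFunctor hS (h₁.subsingleton_ext h_ext 1 le_rfl)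
    have hp : ∀ i, 1 ≤ i → i ≤ e → Subsingleton (Abelian.Ext S.X₂ X i) := by
      intro i h1 h2
      obtain ⟨n, f, g, h⟩ := exists_sum_eq_id_of_add h₂
      exact subsingleton_ext_left_of_sum h _ _ (hs i h1 h2)
    obtain rfl | ⟨j, rfl⟩ : i = 1 ∨ ∃ j, i = j + 2 := by
      obtain h | h : i = 1 ∨ 2 ≤ i := by lia
      · exact .inl h
      · exact .inr (Nat.exists_eq_add_of_le' h)
    · refine subsingleton_ext_one_X₃_left hH (fun α => ?_) (hadd _ h₂ 1 le_rfl)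
      obtain ⟨a, rfl⟩ := exists_map_eq_of_isIso_counit (endAdj s) (h₁.isIso_counit h_ext) α
      obtain ⟨b, rfl⟩ := exists_extension_of_subsingleton_ext hS (hX 1 le_rfl h2) a
      exact ⟨H.map b, (H.map_comp _ _).symm⟩
    · refine subsingleton_ext_X₃_left hH _ (ih (e - 1) (fun i h1 h2 => hs i h1 (by lia))
        (fun i h1 h2 => ?_) (j + 1) (by lia) (by lia)) (hadd _ h₂ (j + 2) (by lia))
      exact subsingleton_ext_X₁_left hS X (hp i h1 (by lia)) (hX (i + 1) (by lia) (by lia))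

end Resolved

/-! ### Extending exact sequences on the left -/

section Precomp

universe v' u'

variable {C : Type u'} [Category.{v'} C]

lemma epi_last_precomp_comp_epi {n : ℕ} {S : ComposableArrows C n} {M N : C} {a : M ⟶ S.left}
    (g : N ⟶ M) (hg : Epi g) (hS : Epi ((S.precomp a).map' n (n + 1))) :
    Epi ((S.precomp (g ≫ a)).map' n (n + 1)) := by
  cases n with
  | zero =>
    have : Epi a := hS
    exact inferInstanceAs (Epi (g ≫ a))
  | succ n => exact hS

variable [Abelian C]

lemma exact_epi_comp {N X Y Z : C} (e : N ⟶ X) (he : Epi e) {f : X ⟶ Y} {g : Y ⟶ Z}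
    {w : f ≫ g = 0} (h : (ShortComplex.mk f g w).Exact) :
    (ShortComplex.mk (e ≫ f) g (by rw [Category.assoc, w, comp_zero])).Exact := by
  let φ : ShortComplex.mk (e ≫ f) g (by rw [Category.assoc, w, comp_zero]) ⟶
      ShortComplex.mk f g w := { τ₁ := e, τ₂ := 𝟙 _, τ₃ := 𝟙 _ }
  have : Epi φ.τ₁ := he
  have : IsIso φ.τ₂ := inferInstanceAs (IsIso (𝟙 _))
  have : Mono φ.τ₃ := inferInstanceAs (Mono (𝟙 _))
  exact (ShortComplex.exact_iff_of_epi_of_isIso_of_mono φ).2 h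

lemma exact_comp_mono {X Y Z N : C} (m : Z ⟶ N) (hm : Mono m) {f : X ⟶ Y} {g : Y ⟶ Z}
    {w : f ≫ g = 0} (h : (ShortComplex.mk f g w).Exact) :
    (ShortComplex.mk f (g ≫ m) (by rw [reassoc_of% w, zero_comp])).Exact := by
  let φ : ShortComplex.mk f g w ⟶
      ShortComplex.mk f (g ≫ m) (by rw [reassoc_of% w, zero_comp]) :=
    { τ₁ := 𝟙 _, τ₂ := 𝟙 _, τ₃ := m }
  have : Epi φ.τ₁ := inferInstanceAs (Epi (𝟙 _))
  have : IsIso φ.τ₂ := inferInstanceAs (IsIso (𝟙 _))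
  have : Mono φ.τ₃ := hm
  exact (ShortComplex.exact_iff_of_epi_of_isIso_of_mono φ).1 h

variable {n : ℕ} {S : ComposableArrows C n}

lemma exact_precomp_precomp {M N : C} {a : M ⟶ S.left} {f : N ⟶ M} {w : f ≫ a = 0}
    (h : (ShortComplex.mk f a w).Exact) (hS : (S.precomp a).Exact) :
    ((S.precomp a).precomp f).Exact :=
  ComposableArrows.exact_of_δ₀ h.exact_toComposableArrows hS

lemma exact_precomp_comp_epi {M N : C} {a : M ⟶ S.left} (g : N ⟶ M) (hg : Epi g)
    (hS : (S.precomp a).Exact) : (S.precomp (g ≫ a)).Exact := by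
  cases n with
  | zero => exact ComposableArrows.exact₁ _
  | succ n =>
    have h : (ShortComplex.mk a (S.map' 0 1) (hS.zero 0)).Exact := hS.exact 0
    exact ComposableArrows.exact_of_δ₀ (exact_epi_comp g hg h).exact_toComposableArrows hS.δ₀

end Precomp

/-! ### Approximations in a `d`-cluster tilting subcategory -/

section ClusterTilting

variable {R : Type u} [Ring R] {d : ℕ} {F : ObjectProperty (ModuleCat.{u} R)}

lemma isFG_of_epi {M N : ModuleCat.{u} R} (f : M ⟶ N) (hf : Epi f)
    (hM : ModuleCat.isFG R M) : ModuleCat.isFG R N := by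
  have : Module.Finite R M := hM
  exact Module.Finite.of_surjective f.hom ((ModuleCat.epi_iff_surjective f).1 hf)

lemma isFG_of_mono [IsNoetherianRing R] {M N : ModuleCat.{u} R} (f : M ⟶ N) (hf : Mono f)
    (hN : ModuleCat.isFG R N) : ModuleCat.isFG R M := by
  have : Module.Finite R N := hN
  exact Module.Finite.of_injective f.hom ((ModuleCat.mono_iff_injective f).1 hf)

namespace IsDClusterTilting

lemma subsingleton_ext (hF : IsDClusterTilting d F) {x y : ModuleCat.{u} R} (hx : F x) (hy : F y)
    (i : ℕ) (h1 : 1 ≤ i) (h2 : i < d) : Subsingleton (Abelian.Ext x y i) :=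
  (hF.iff_right y (hF.le_isFG _ hy)).1 hy x hx i h1 h2

lemma of_injective (hF : IsDClusterTilting d F) {I : ModuleCat.{u} R}
    (hI : ModuleCat.isFG R I) [Injective I] : F I := by
  refine (hF.iff_right I hI).2 fun x _ i h1 _ => ?_
  obtain ⟨j, rfl⟩ := Nat.exists_eq_add_of_le' h1
  exact Abelian.Ext.subsingleton_of_injective x I j

lemma of_projective (hF : IsDClusterTilting d F) {P : ModuleCat.{u} R}
    (hP : ModuleCat.isFG R P) [Projective P] : F P := by
  refine (hF.iff_left P hP).2 fun x _ i h1 _ => ?_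
  obtain ⟨j, rfl⟩ := Nat.exists_eq_add_of_le' h1
  exact Abelian.Ext.subsingleton_of_projective P x j

lemma self (hF : IsDClusterTilting d F) : F (ModuleCat.of R R) := by
  have : Projective (ModuleCat.of R R) := (IsProjective.iff_projective R).1 inferInstance
  exact hF.of_projective (inferInstanceAs (Module.Finite R R))

lemma of_isZero (hF : IsDClusterTilting d F) {X : ModuleCat.{u} R} (hX : IsZero X) : F X := by
  have := hX.injective
  have : Subsingleton X := ModuleCat.subsingleton_of_isZero hX
  exact hF.of_injective (inferInstanceAs (Module.Finite R X))

lemma biprod (hF : IsDClusterTilting d F) {X Y : ModuleCat.{u} R} (hX : F X) (hY : F Y) :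
    F (X ⊞ Y) := by
  have h1 : Module.Finite R X := hF.le_isFG _ hX
  have h2 : Module.Finite R Y := hF.le_isFG _ hY
  have hfg : ModuleCat.isFG R (X ⊞ Y) :=
    isFG_of_epi (ModuleCat.biprodIsoProd X Y).inv inferInstance
      (inferInstanceAs (Module.Finite R (X × Y)))
  refine (hF.iff_right _ hfg).2 fun x hx i h1 h2 => ?_
  have := hF.subsingleton_ext hx hX i h1 h2
  have := hF.subsingleton_ext hx hY i h1 h2
  exact Abelian.Ext.addEquivBiprod.toEquiv.subsingleton

/-- A finitely generated module `M` whose `Ext^i` into `F` vanishes for `1 ≤ i ≤ j` embeds into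
an object of `F` in such a way that the cokernel has the same property for `j + 1`. -/
lemma exists_coresolution_step (hF : IsDClusterTilting d F)
    (hinj : ∀ M, ModuleCat.isFG R M → ∃ (I : ModuleCat.{u} R) (f : M ⟶ I),
      Mono f ∧ Injective I ∧ ModuleCat.isFG R I)
    {M : ModuleCat.{u} R} (hM : ModuleCat.isFG R M) {j : ℕ} (hj : j + 1 < d)
    (hMj : ∀ x, F x → ∀ i, 1 ≤ i → i ≤ j → Subsingleton (Abelian.Ext M x i)) :
    ∃ (w N : ModuleCat.{u} R) (f : M ⟶ w) (g : w ⟶ N) (zero : f ≫ g = 0),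
      (ShortComplex.mk f g zero).ShortExact ∧ F w ∧ ModuleCat.isFG R N ∧
      ∀ x, F x → ∀ i, 1 ≤ i → i ≤ j + 1 → Subsingleton (Abelian.Ext N x i) := by
  obtain ⟨w, hw, φ, hφ⟩ := hF.functoriallyFinite.preenveloping M hM
  obtain ⟨I, f, hf, hI, hIfg⟩ := hinj M hM
  have : Mono φ := by
    obtain ⟨g, rfl⟩ := hφ I (hF.of_injective hIfg) f
    exact mono_of_mono φ g
  have hS : (ShortComplex.mk φ (cokernel.π φ) (cokernel.condition φ)).ShortExact :=
    { exact := ShortComplex.exact_cokernel φ, mono_f := this,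
      epi_g := inferInstanceAs (Epi (cokernel.π φ)) }
  refine ⟨w, cokernel φ, φ, cokernel.π φ, cokernel.condition φ, hS, hw,
    isFG_of_epi (cokernel.π φ) inferInstance (hF.le_isFG _ hw), fun x hx i h1 h2 => ?_⟩
  obtain rfl | ⟨k, rfl⟩ : i = 1 ∨ ∃ k, i = k + 1 + 1 := by
    obtain h | h : i = 1 ∨ 2 ≤ i := by lia
    · exact .inl h
    · exact .inr (Nat.exists_eq_add_of_le' h)
  · exact subsingleton_ext_one_X₃_left hS (hφ x hx) (hF.subsingleton_ext hw hx 1 le_rfl (by lia))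
  · exact subsingleton_ext_X₃_left hS x (hMj x hx (k + 1) (by lia) (by lia))
      (hF.subsingleton_ext hw hx (k + 1 + 1) (by lia) (by lia))

/-- A module into which no object of `F` has higher extensions receives no higher extensions from
any finitely generated module. -/
lemma subsingleton_ext_of_forall (hF : IsDClusterTilting d F)
    (hinj : ∀ M, ModuleCat.isFG R M → ∃ (I : ModuleCat.{u} R) (f : M ⟶ I),
      Mono f ∧ Injective I ∧ ModuleCat.isFG R I)
    {J : ModuleCat.{u} R} (hJ : ∀ x, F x → ∀ i, 1 ≤ i → Subsingleton (Abelian.Ext x J i))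
    (k j : ℕ) (hk : j + k + 1 = d) (M : ModuleCat.{u} R) (hM : ModuleCat.isFG R M)
    (hMj : ∀ x, F x → ∀ i, 1 ≤ i → i ≤ j → Subsingleton (Abelian.Ext M x i)) (i : ℕ)
    (hi : 1 ≤ i) : Subsingleton (Abelian.Ext M J i) := by
  induction k generalizing j M i with
  | zero =>
    exact hJ M ((hF.iff_left M hM).2 fun x hx i h1 h2 => hMj x hx i h1 (by lia)) i hi
  | succ k ih =>
    obtain ⟨w, N, f, g, zero, hS, hw, hN, hNj⟩ :=
      hF.exists_coresolution_step hinj hM (by lia) hMj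
    exact subsingleton_ext_X₁_left hS J (hJ w hw i hi)
      (ih (j + 1) (by lia) N hN hNj (i + 1) (by lia))

/-- A finitely generated module `M` has a coresolution `0 → M → S_0 → ⋯ → S_k → 0` in `F`, where
`k = d - 1` in general and `k = d - 1 - j` if `Ext^i(M, F) = 0` for `1 ≤ i ≤ j`. -/
lemma exists_coresolution (hF : IsDClusterTilting d F)
    (hinj : ∀ M, ModuleCat.isFG R M → ∃ (I : ModuleCat.{u} R) (f : M ⟶ I),
      Mono f ∧ Injective I ∧ ModuleCat.isFG R I)
    (k j : ℕ) (hk : j + k + 1 = d) (M : ModuleCat.{u} R) (hM : ModuleCat.isFG R M)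
    (hMj : ∀ x, F x → ∀ i, 1 ≤ i → i ≤ j → Subsingleton (Abelian.Ext M x i)) :
    ∃ (S : ComposableArrows (ModuleCat.{u} R) k) (a : M ⟶ S.left),
      (S.precomp a).Exact ∧ Mono a ∧ Epi ((S.precomp a).map' k (k + 1)) ∧ ∀ i, F (S.obj i) := by
  induction k generalizing j M with
  | zero =>
    exact ⟨ComposableArrows.mk₀ M, 𝟙 M, ComposableArrows.exact₁ _, inferInstanceAs (Mono (𝟙 M)),
      inferInstanceAs (Epi (𝟙 M)),
      fun _ => (hF.iff_left M hM).2 fun x hx i h1 h2 => hMj x hx i h1 (by lia)⟩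
  | succ k ih =>
    obtain ⟨w, N, f, g, zero, hS, hw, hN, hNj⟩ :=
      hF.exists_coresolution_step hinj hM (by lia) hMj
    obtain ⟨S, a, hexact, hmono, hepi, hSF⟩ := ih (j + 1) (by lia) N hN hNj
    refine ⟨S.precomp (g ≫ a), f, exact_precomp_precomp (exact_comp_mono a hmono hS.exact)
      (exact_precomp_comp_epi g hS.epi_g hexact), hS.mono_f,
      epi_last_precomp_comp_epi g hS.epi_g hepi, ?_⟩
    intro i
    cases i using Fin.cases with
    | zero => exact hw
    | succ i => exact hSF i

/-- Each morphism of `F` is the beginning of an exact sequence `X → Y → w_{d-1} → ⋯ → w_0 → 0`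
in `F`. -/
lemma exists_exact_of_hom_left {k : ℕ} (hF : IsDClusterTilting (k + 1) F)
    (hinj : ∀ M, ModuleCat.isFG R M → ∃ (I : ModuleCat.{u} R) (f : M ⟶ I),
      Mono f ∧ Injective I ∧ ModuleCat.isFG R I)
    {X Y : ModuleCat.{u} R} (f : X ⟶ Y) (hX : F X) (hY : F Y) :
    ∃ S : ComposableArrows (ModuleCat.{u} R) (k + 2), S.Exact ∧ Epi (S.map' (k + 1) (k + 2)) ∧
      (∀ i, F (S.obj i)) ∧ Nonempty (Arrow.mk (S.map' 0 1) ≅ Arrow.mk f) := by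
  obtain ⟨S, a, hexact, hmono, hepi, hSF⟩ := hF.exists_coresolution hinj k 0 (by lia) (cokernel f)
    (isFG_of_epi (cokernel.π f) inferInstance (hF.le_isFG _ hY)) (fun _ _ _ _ _ => by lia)
  refine ⟨(S.precomp (cokernel.π f ≫ a)).precomp f,
    exact_precomp_precomp (exact_comp_mono a hmono (ShortComplex.exact_cokernel f))
      (exact_precomp_comp_epi _ inferInstance hexact),
    epi_last_precomp_comp_epi (cokernel.π f) inferInstance hepi, ?_, ⟨Iso.refl _⟩⟩
  intro i
  cases i using Fin.cases with
  | zero => exact hX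
  | succ i =>
    cases i using Fin.cases with
    | zero => exact hY
    | succ i => exact hSF i

/-- If `Ext^i(x, ker g)` vanishes for `x` in `F` and `1 ≤ i ≤ j`, then `g` can be extended to the
left to an exact sequence by a morphism from `F` whose kernel has this property for `j + 1`. -/
lemma exists_resolution_step [IsNoetherianRing R] (hF : IsDClusterTilting d F)
    {X Y : ModuleCat.{u} R} (g : X ⟶ Y) (hX : F X) {j : ℕ} (hj : j + 1 < d)
    (hK : ∀ x, F x → ∀ i, 1 ≤ i → i ≤ j → Subsingleton (Abelian.Ext x (kernel g) i)) :
    ∃ (w : ModuleCat.{u} R) (f : w ⟶ X) (zero : f ≫ g = 0), F w ∧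
      (ShortComplex.mk f g zero).Exact ∧
      ∀ x, F x → ∀ i, 1 ≤ i → i ≤ j + 1 → Subsingleton (Abelian.Ext x (kernel f) i) := by
  obtain ⟨w, hw, c, hc⟩ := hF.functoriallyFinite.precovering (kernel g)
    (isFG_of_mono (kernel.ι g) inferInstance (hF.le_isFG _ hX))
  -- the precover is surjective since `F` contains `R`
  have hcepi : Epi c := by
    refine (ModuleCat.epi_iff_surjective c).2 fun y => ?_
    obtain ⟨g, hg⟩ := hc _ hF.self (ModuleCat.ofHom (LinearMap.toSpanSingleton R _ y))
    refine ⟨g.hom (1 : R), ?_⟩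
    have := congrArg (fun h => h.hom (1 : R)) hg
    simpa using this
  have hex := exact_epi_comp c hcepi (ShortComplex.exact_kernel g)
  refine ⟨w, c ≫ kernel.ι g, by simp, hw, hex, fun x hx i h1 h2 => ?_⟩
  have hE := exact_kernel_lift _ hex
  obtain rfl | ⟨k, rfl⟩ : i = 1 ∨ ∃ k, i = k + 1 + 1 := by
    obtain h | h : i = 1 ∨ 2 ≤ i := by lia
    · exact .inl h
    · exact .inr (Nat.exists_eq_add_of_le' h)
  · refine subsingleton_ext_one_X₁_right hE (fun f => ?_)
      (hF.subsingleton_ext hx hw 1 le_rfl (by lia))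
    obtain ⟨g, rfl⟩ := hc x hx f
    exact ⟨g, by rw [← cancel_mono (kernel.ι _)]; simp⟩
  · exact subsingleton_ext_X₁_right hE x (hK x hx (k + 1) (by lia) (by lia))
      (hF.subsingleton_ext hx hw (k + 1 + 1) (by lia) (by lia))

/-- Each morphism `f` of `F` is the end of an exact sequence in `F` with `j` further terms and with
`Ext^i(F, -) = 0` on the left kernel for `1 ≤ i ≤ j`. -/
lemma exists_resolution_aux [IsNoetherianRing R] (hF : IsDClusterTilting d F)
    {X Y : ModuleCat.{u} R} (f : X ⟶ Y) (hX : F X) (hY : F Y) (j : ℕ) (hj : j + 1 ≤ d) :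
    ∃ S : ComposableArrows (ModuleCat.{u} R) (j + 1), S.Exact ∧ (∀ i, F (S.obj i)) ∧
      (∀ x, F x → ∀ i, 1 ≤ i → i ≤ j → Subsingleton (Abelian.Ext x (kernel (S.map' 0 1)) i)) ∧
      Nonempty (Arrow.mk (S.map' j (j + 1)) ≅ Arrow.mk f) := by
  induction j with
  | zero =>
    refine ⟨ComposableArrows.mk₁ f, ComposableArrows.exact₁ _, fun i => ?_,
      fun _ _ _ _ _ => by lia, ⟨Iso.refl _⟩⟩
    fin_cases i
    · exact hX
    · exact hY
  | succ j ih =>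
    obtain ⟨S, hS, hSF, hK, hf⟩ := ih (by lia)
    obtain ⟨w, c, zero, hw, hex, hc⟩ := hF.exists_resolution_step _ (hSF 0) (by lia) hK
    refine ⟨S.precomp c, ComposableArrows.exact_of_δ₀ hex.exact_toComposableArrows hS,
      fun i => ?_, hc, hf⟩
    cases i using Fin.cases with
    | zero => exact hw
    | succ i => exact hSF i

/-- Each morphism of `F` is the end of an exact sequence `0 → w_{d+1} → ⋯ → w_2 → X → Y`
in `F`. -/
lemma exists_exact_of_hom_right [IsNoetherianRing R] {k : ℕ} (hF : IsDClusterTilting (k + 1) F)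
    {X Y : ModuleCat.{u} R} (f : X ⟶ Y) (hX : F X) (hY : F Y) :
    ∃ S : ComposableArrows (ModuleCat.{u} R) (k + 2), S.Exact ∧ Mono (S.map' 0 1) ∧
      (∀ i, F (S.obj i)) ∧ Nonempty (Arrow.mk (S.map' (k + 1) (k + 2)) ≅ Arrow.mk f) := by
  obtain ⟨S, hS, hSF, hK, hf⟩ := hF.exists_resolution_aux f hX hY k le_rfl
  let c := kernel.ι (S.map' 0 1)
  refine ⟨S.precomp c, ComposableArrows.exact_of_δ₀
    (ShortComplex.exact_kernel (S.map' 0 1)).exact_toComposableArrows hS,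
    inferInstanceAs (Mono c), fun i => ?_, hf⟩
  cases i using Fin.cases with
  | zero =>
    exact (hF.iff_right _ (isFG_of_mono c inferInstance
      (hF.le_isFG _ (hSF 0)))).2 fun x hx i h1 h2 => hK x hx i h1 (by lia)
  | succ i => exact hSF i

end IsDClusterTilting

end ClusterTilting

/-! ### Modules over finite dimensional algebras -/

section FiniteDimensional

variable {k : Type*} [Field k] {A : Type u} [Ring A] [Algebra k A]

/-- An `A`-module that embeds `k`-linearly into a finite dimensional vector space is finitely
generated. -/
lemma finite_of_injective_addHom {X V : Type*} [AddCommGroup X] [Module A X] [AddCommGroup V]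
    [Module k V] [Module.Finite k V] (φ : X →+ V) (hφ : Function.Injective φ)
    (h : ∀ (c : k) (x : X), φ (algebraMap k A c • x) = c • φ x) : Module.Finite A X := by
  let _ : Module k X := Module.compHom X (algebraMap k A)
  have : IsScalarTower k A X := IsScalarTower.of_algebraMap_smul fun _ _ => rfl
  let ψ : X →ₗ[k] V := { toFun := φ, map_add' := φ.map_add, map_smul' := h }
  have : Module.Finite k X := Module.Finite.of_injective ψ hφ
  exact Module.Finite.of_restrictScalars_finite k A X

variable [Module.Finite k A]

lemma finite_restrictScalars (M : ModuleCat.{u} A) (hM : ModuleCat.isFG A M) :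
    Module.Finite k ((ModuleCat.restrictScalars (algebraMap k A)).obj M) := by
  let _ : Module k M := Module.compHom M (algebraMap k A)
  have : IsScalarTower k A M := IsScalarTower.of_algebraMap_smul fun _ _ => rfl
  have : Module.Finite A M := hM
  exact (Module.Finite.trans A M : Module.Finite k M)

/-- Over a finite dimensional algebra, a finitely generated module `M` embeds into the finitely
generated injective module `Hom_k(A, M)`. -/
lemma exists_mono_injective (k : Type*) [Field k] {A : Type u} [Ring A] [Algebra k A]
    [Module.Finite k A] (M : ModuleCat.{u} A) (hM : ModuleCat.isFG A M) :
    ∃ (I : ModuleCat.{u} A) (f : M ⟶ I), Mono f ∧ Injective I ∧ ModuleCat.isFG A I := by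
  let adj := ModuleCat.restrictCoextendScalarsAdj.{u, _, u} (algebraMap k A)
  let V := (ModuleCat.restrictScalars (algebraMap k A)).obj M
  have hV : Injective V := ⟨fun {X Y} g f hf => by
    have hk : LinearMap.ker f.hom = ⊥ :=
      LinearMap.ker_eq_bot.2 ((ModuleCat.mono_iff_injective f).1 hf)
    obtain ⟨r, hr⟩ := f.hom.exists_leftInverse_of_injective hk
    have hfr : f ≫ ModuleCat.ofHom r = 𝟙 X := ModuleCat.hom_ext hr
    exact ⟨ModuleCat.ofHom r ≫ g, by rw [reassoc_of% hfr]⟩⟩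
  refine ⟨_, adj.unit.app M, inferInstance, adj.map_injective V hV, ?_⟩
  have h1 : Module.Finite k V := finite_restrictScalars M hM
  have h2 : Module.Finite k ((ModuleCat.restrictScalars (algebraMap k A)).obj (ModuleCat.of A A)) :=
    finite_restrictScalars _ (inferInstanceAs (Module.Finite A A))
  refine finite_of_injective_addHom (k := k)
    (V := (ModuleCat.restrictScalars (algebraMap k A)).obj (ModuleCat.of A A) →ₗ[k] V)
    (ModuleCat.CoextendScalars.equiv (algebraMap k A) V).toLinearMap.toAddMonoidHom
    (ModuleCat.CoextendScalars.equiv (algebraMap k A) V).injective fun c x => ?_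
  refine LinearMap.ext fun a => ?_
  have h : (show A from a) * algebraMap k A c = algebraMap k A c * (show A from a) :=
    (Algebra.commutes c (show A from a)).symm
  exact (congrArg (ModuleCat.CoextendScalars.equiv (algebraMap k A) V x) h).trans
    ((ModuleCat.CoextendScalars.equiv (algebraMap k A) V x).map_smul c a)

/-- The endomorphism ring of a finitely generated module over a finite dimensional algebra is a
finite dimensional algebra, in which scalars act on the module through the original algebra. -/
lemma exists_algebra_end (k : Type*) [Field k] {A : Type u} [Ring A] [Algebra k A]
    [Module.Finite k A] (s : ModuleCat.{u} A) (hs : ModuleCat.isFG A s) :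
    ∃ _ : Algebra k (Module.End A s)ᵐᵒᵖ, Module.Finite k (Module.End A s)ᵐᵒᵖ ∧
      ∀ (c : k) (x : s), (algebraMap k (Module.End A s)ᵐᵒᵖ c).unop x = algebraMap k A c • x := by
  let _ : Module k s := Module.compHom s (algebraMap k A)
  have : IsScalarTower k A s := IsScalarTower.of_algebraMap_smul fun _ _ => rfl
  have : Module.Finite A s := hs
  have : Module.Finite k s := Module.Finite.trans A s
  have : SMulCommClass A k s := IsScalarTower.to_smulCommClass'
  refine ⟨inferInstance, ?_, fun c x => rfl⟩
  let φ : Module.End A s →ₗ[k] (s →ₗ[k] s) :=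
    { toFun := fun f => f.restrictScalars k
      map_add' := fun _ _ => rfl
      map_smul' := fun _ _ => rfl }
  have : Module.Finite k (Module.End A s) :=
    Module.Finite.of_injective φ (LinearMap.restrictScalars_injective k)
  exact Module.Finite.equiv (MulOpposite.opLinearEquiv k)

/-- For finitely generated `X`, the `Γ`-module `Hom_A(s, X)` is finite dimensional. -/
lemma isFG_homFunctor {s : ModuleCat.{u} A} (hs : ModuleCat.isFG A s)
    [Algebra k (Module.End A s)ᵐᵒᵖ]
    (h : ∀ (c : k) (x : s),
      (algebraMap k (Module.End A s)ᵐᵒᵖ c).unop x = algebraMap k A c • x)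
    {X : ModuleCat.{u} A} (hX : ModuleCat.isFG A X) :
    ModuleCat.isFG (Module.End A s)ᵐᵒᵖ ((homFunctor (Module.End A s) A s).obj X) := by
  let V (M : ModuleCat.{u} A) := (ModuleCat.restrictScalars (algebraMap k A)).obj M
  have h1 : Module.Finite k (V s) := finite_restrictScalars s hs
  have h2 : Module.Finite k (V X) := finite_restrictScalars X hX
  let φ : HomModule (Module.End A s) A s X →+ (V s →ₗ[k] V X) :=
    { toFun := fun f => ((ModuleCat.restrictScalars (algebraMap k A)).map
        (ModuleCat.ofHom (f : s →ₗ[A] X))).hom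
      map_zero' := rfl
      map_add' := fun _ _ => rfl }
  refine finite_of_injective_addHom (k := k) φ (fun f g hfg => LinearMap.ext fun x =>
    LinearMap.congr_fun hfg x) fun c f => LinearMap.ext fun x => ?_
  let f' : s →ₗ[A] X := f
  exact (congrArg f' (h c x)).trans (f'.map_smul (algebraMap k A c) x)

end FiniteDimensional

/-! ### Baer's criterion in terms of `Ext` -/

section Baer

/-- Baer's criterion, applied to the extensions of the cyclic modules `A ⧸ I`. -/
lemma injective_of_subsingleton_ext {A : Type u} [Ring A] (J : ModuleCat.{u} A)
    (hJ : ∀ M, ModuleCat.isFG A M → Subsingleton (Abelian.Ext M J 1)) : Injective J := by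
  have : Module.Baer A J := by
    intro I g
    have hS : (ShortComplex.mk (ModuleCat.ofHom I.subtype) (ModuleCat.ofHom I.mkQ)
        (ModuleCat.hom_ext (LinearMap.ext fun x => by simp))).ShortExact := by
      refine ModuleCat.shortComplex_shortExact _ ?_ I.injective_subtype I.mkQ_surjective
      exact LinearMap.exact_subtype_mkQ I
    obtain ⟨h, hh⟩ := exists_extension_of_subsingleton_ext hS
      (hJ _ (inferInstanceAs (Module.Finite A (A ⧸ I)))) (ModuleCat.ofHom g)
    exact ⟨h.hom, fun x hx => congrArg (fun f => f.hom ⟨x, hx⟩) hh⟩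
  have := this.injective
  exact Module.injective_object_of_injective_module A J

end Baer

/-! ### `d`-exact sequences in a `d`-cluster tilting subcategory -/

section DExactSequences

variable {R : Type u} [Ring R] {d : ℕ} {F : ObjectProperty (ModuleCat.{u} R)}

/-- An exact sequence `0 → S_0 → ⋯ → S_{d+1}` of modules in `F` is a `d`-kernel in `F`: the
obstructions to exactness of `Hom(m, -)` are shifted to `Ext^i(m, S_j)` with `1 ≤ i < d`. -/
lemma IsDClusterTilting.isDKernel_lift (hF : IsDClusterTilting d F)
    {S : ComposableArrows (ModuleCat.{u} R) (d + 1)} (hS : S.Exact) (hmono : Mono (S.map' 0 1))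
    (hSF : ∀ i, F (S.obj i)) :
    IsDKernel (show ComposableArrows F.FullSubcategory (d + 1) from F.lift S hSF) where
  injective m f g hfg := by
    refine F.hom_ext ?_
    refine hmono.right_cancellation _ _ ?_
    exact congrArg (·.hom) hfg
  exact m i hi f := by
    constructor
    · intro hf
      have hK := subsingleton_ext_kernel hS m.obj d
        (fun j hj i h1 h2 => hF.subsingleton_ext m.property (hSF _) i h1 h2)
        (fun _ i _ _ => subsingleton_ext_right_of_isZero
          (isZero_kernel_of_mono (S.map (homOfLE (Nat.zero_le 1)))) _ i)
        i (by lia) 1 le_rfl (by lia)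
      obtain ⟨g, hg⟩ := exists_lift_of_exact hS i hi hK f.hom (congrArg (·.hom) hf)
      exact ⟨ObjectProperty.homMk g, F.hom_ext hg⟩
    · rintro ⟨g, rfl⟩
      refine F.hom_ext ?_
      change (g.hom ≫ S.map' i (i + 1)) ≫ S.map' (i + 1) (i + 2) = 0
      rw [Category.assoc, hS.zero i, comp_zero]

lemma IsDClusterTilting.isDCokernel_lift (hF : IsDClusterTilting d F)
    {S : ComposableArrows (ModuleCat.{u} R) (d + 1)} (hS : S.Exact)
    (hepi : Epi (S.map' d (d + 1))) (hSF : ∀ i, F (S.obj i)) :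
    IsDCokernel (show ComposableArrows F.FullSubcategory (d + 1) from F.lift S hSF) where
  injective m f g hfg := by
    refine F.hom_ext ?_
    refine hepi.left_cancellation _ _ ?_
    exact congrArg (·.hom) hfg
  exact m i hi f := by
    constructor
    · intro hf
      obtain ⟨g, hg⟩ := exists_extension_of_exact hS hepi
        (fun j hj i h1 h2 => hF.subsingleton_ext (hSF _) m.property i h1 h2) i hi f.hom
        (congrArg (·.hom) hf)
      exact ⟨ObjectProperty.homMk g, F.hom_ext hg⟩
    · rintro ⟨g, rfl⟩
      refine F.hom_ext ?_
      change S.map' i (i + 1) ≫ S.map' (i + 1) (i + 2) ≫ g.hom = 0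
      rw [← Category.assoc, hS.zero i, zero_comp]

variable {S : ComposableArrows F.FullSubcategory (d + 1)}

/-- `Hom_R(x, -)` is exact on a `d`-kernel, for each `x` in `F`. -/
lemma exists_lift_of_isDKernel (hS : IsDKernel S) {x : ModuleCat.{u} R} (hx : F x) (i : ℕ)
    (hi : i + 2 ≤ d + 1) (f : x ⟶ (S.obj' (i + 1)).obj)
    (hf : f ≫ (S.map' (i + 1) (i + 2)).hom = 0) :
    ∃ g : x ⟶ (S.obj' i).obj, g ≫ (S.map' i (i + 1)).hom = f := by
  let m : F.FullSubcategory := ⟨x, hx⟩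
  let f' : m ⟶ S.obj' (i + 1) := ObjectProperty.homMk f
  obtain ⟨g, hg⟩ := (hS.exact m i hi f').1 (F.hom_ext hf)
  exact ⟨g.hom, congrArg (·.hom) hg⟩

lemma isComplex_of_isDKernel (hS : IsDKernel S) :
    ComposableArrows.IsComplex (S ⋙ F.ι : ComposableArrows (ModuleCat.{u} R) (d + 1)) where
  zero i hi := by
    have h := (hS.exact (S.obj' i) i hi).apply_apply_eq_zero (𝟙 _)
    have h' := congrArg (·.hom) h
    change (𝟙 (S.obj' i).obj ≫ (S.map' i (i + 1)).hom) ≫ (S.map' (i + 1) (i + 2)).hom = 0 at h'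
    rwa [Category.id_comp] at h'

/-- Exactness can be tested on maps from `R`, which lies in `F`. -/
lemma exact_of_isDKernel (hF : IsDClusterTilting d F) (hS : IsDKernel S) :
    ComposableArrows.Exact (S ⋙ F.ι : ComposableArrows (ModuleCat.{u} R) (d + 1)) where
  toIsComplex := isComplex_of_isDKernel hS
  exact i hi := by
    rw [ShortComplex.moduleCat_exact_iff]
    intro y hy
    obtain ⟨g, hg⟩ := exists_lift_of_isDKernel hS hF.self i hi
      (ModuleCat.ofHom (LinearMap.toSpanSingleton R _ y))
      (ModuleCat.hom_ext (LinearMap.ext_ring (by simpa using hy)))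
    refine ⟨g.hom (1 : R), ?_⟩
    have := congrArg (fun h => h.hom (1 : R)) hg
    simpa using this

lemma mono_of_isDKernel (hF : IsDClusterTilting d F) (hS : IsDKernel S) :
    Mono (S.map' 0 1).hom := by
  rw [ModuleCat.mono_iff_injective]
  intro x y hxy
  let m : F.FullSubcategory := ⟨_, hF.self⟩
  let φ (x : (S.obj' 0).obj) : m ⟶ S.obj' 0 :=
    ObjectProperty.homMk (ModuleCat.ofHom (LinearMap.toSpanSingleton R _ x))
  have h : φ x = φ y := by
    refine hS.injective m (F.hom_ext (ModuleCat.hom_ext (LinearMap.ext_ring ?_)))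
    let g := (S.map' 0 1).hom
    exact (congrArg g (one_smul R x)).trans (hxy.trans (congrArg g (one_smul R y)).symm)
  exact (one_smul R x).symm.trans ((congrArg (fun h => h.hom.hom (1 : R)) h).trans
    (one_smul R y))

lemma epi_of_isDCokernel (hF : IsDClusterTilting d F)
    (hinj : ∀ M, ModuleCat.isFG R M → ∃ (I : ModuleCat.{u} R) (f : M ⟶ I),
      Mono f ∧ Injective I ∧ ModuleCat.isFG R I) (hS : IsDCokernel S) :
    Epi (S.map' d (d + 1)).hom := by
  set g := (S.map' d (d + 1)).hom
  -- the cokernel embeds into an object of `F`, which detects that it vanishes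
  obtain ⟨I, f, hf, hI, hIfg⟩ := hinj (cokernel g) (isFG_of_epi (cokernel.π g) inferInstance
    (hF.le_isFG _ (S.obj' (d + 1)).property))
  let m : F.FullSubcategory := ⟨I, hF.of_injective hIfg⟩
  let φ : S.obj' (d + 1) ⟶ m := ObjectProperty.homMk (cokernel.π g ≫ f)
  have h : φ = 0 := hS.injective m (F.hom_ext (by
    change g ≫ cokernel.π g ≫ f = g ≫ 0
    rw [cokernel.condition_assoc, zero_comp, comp_zero]))
  have h' : cokernel.π g ≫ f = 0 := congrArg (·.hom) h
  exact Abelian.epi_of_cokernel_π_eq_zero _ (zero_of_comp_mono f h')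

end DExactSequences

/-! ### Transport along the adjunction -/

section Transport

variable {R : Type u} [Ring R] {s : ModuleCat.{u} R} {k : ℕ}
  {F W : ObjectProperty (ModuleCat.{u} R)}

/-- The functor `Hom_R(s, -)` to right modules over `End_R(s)`. -/
abbrev endHom (s : ModuleCat.{u} R) : ModuleCat.{u} R ⥤ ModuleCat.{u} (Module.End R s)ᵐᵒᵖ :=
  homFunctor (Module.End R s) R s

/-- The functor `- ⊗ s` from right modules over `End_R(s)`. -/
abbrev endTensor (s : ModuleCat.{u} R) : ModuleCat.{u} (Module.End R s)ᵐᵒᵖ ⥤ ModuleCat.{u} R :=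
  tensorFunctor (Module.End R s) R s

/-- `Hom_R(s, -)` preserves injectives: the objects of the `d`-cluster tilting subcategory have no
higher extensions into `Hom_R(s, I)`, hence neither do the modules coresolved by them. -/
lemma injective_endHom_obj (h_ext : ∀ i : ℕ, 1 ≤ i → Subsingleton (Abelian.Ext s s i))
    (hres : ∀ w, W w → FinitelyResolved s w) (hG : IsDClusterTilting (k + 1) (W.map (endHom s)))
    (hinj : ∀ M, ModuleCat.isFG (Module.End R s)ᵐᵒᵖ M →
      ∃ (I : ModuleCat.{u} (Module.End R s)ᵐᵒᵖ) (f : M ⟶ I),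
        Mono f ∧ Injective I ∧ ModuleCat.isFG (Module.End R s)ᵐᵒᵖ I)
    (I : ModuleCat.{u} R) (hI : Injective I) : Injective ((endHom s).obj I) := by
  have hext : ∀ (X : ModuleCat.{u} R) (i : ℕ), 1 ≤ i → Subsingleton (Abelian.Ext X I i) := by
    intro X i hi
    obtain ⟨j, rfl⟩ := Nat.exists_eq_add_of_le' hi
    exact Abelian.Ext.subsingleton_of_injective X I j
  refine injective_of_subsingleton_ext _ fun M hM => ?_
  refine hG.subsingleton_ext_of_forall hinj ?_ k 0 (by lia) M hM (fun _ _ _ _ _ => by lia) 1 le_rfl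
  rintro x ⟨w, hw, ⟨e⟩⟩ i hi
  exact subsingleton_ext_left_of_sum (ι := Unit) (f := fun _ => e.inv) (g := fun _ => e.hom)
    (by simp) _ i ((hres w hw).subsingleton_ext_homFunctor h_ext I i
      (fun i h1 _ => hext s i h1) (fun i h1 _ => hext w i h1) i hi le_rfl)

/-- Since `Hom_R(s, -)` preserves injectives, its left adjoint `- ⊗_Γ s` is exact. -/
lemma preservesHomology_endTensor
    (hinj : ∀ I : ModuleCat.{u} R, Injective I → Injective ((endHom s).obj I)) :
    (endTensor s).PreservesHomology := by
  have : (endHom s).PreservesInjectiveObjects := ⟨fun {I} h => hinj I h⟩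
  have := Functor.preservesMonomorphisms_of_adjunction_of_preservesInjectiveObjects (endAdj s)
  exact Functor.preservesHomology_of_preservesMonos_and_cokernels _

lemma exact_comp_of_preservesHomology {C D : Type*} [Category* C] [Category* D] [Abelian C]
    [Abelian D] {n : ℕ} {S : ComposableArrows C n} (hS : S.Exact) (T : C ⥤ D)
    [T.PreservesZeroMorphisms] [T.PreservesHomology] :
    ComposableArrows.Exact (S ⋙ T : ComposableArrows D n) where
  zero i hi := by
    change T.map (S.map' i (i + 1)) ≫ T.map (S.map' (i + 1) (i + 2)) = 0
    rw [← T.map_comp, hS.zero i, T.map_zero]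
  exact i hi := (hS.exact i hi).map T

/-- `Hom_R(s, -)` maps all of `F`, and not just `W`, into the essential image of `W`, since
`Ext^i(Hom_R(s, w), Hom_R(s, m)) = 0` for `w` in `W`, `m` in `F` and `1 ≤ i < d`. -/
lemma prop_endHom_obj (h_ext : ∀ i : ℕ, 1 ≤ i → Subsingleton (Abelian.Ext s s i))
    (hres : ∀ w, W w → FinitelyResolved s w) (hG : IsDClusterTilting (k + 1) (W.map (endHom s)))
    (hF : IsDClusterTilting (k + 1) F) (hWF : W ≤ F) (hs : W s)
    (hfg : ∀ X, ModuleCat.isFG R X → ModuleCat.isFG (Module.End R s)ᵐᵒᵖ ((endHom s).obj X))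
    {m : ModuleCat.{u} R} (hm : F m) : W.map (endHom s) ((endHom s).obj m) := by
  refine (hG.iff_right _ (hfg m (hF.le_isFG _ hm))).2 ?_
  rintro x ⟨w, hw, ⟨e⟩⟩ i h1 h2
  exact subsingleton_ext_left_of_sum (ι := Unit) (f := fun _ => e.inv) (g := fun _ => e.hom)
    (by simp) _ i ((hres w hw).subsingleton_ext_homFunctor h_ext m k
      (fun i h1 h2 => hF.subsingleton_ext (hWF _ hs) hm i h1 (by lia))
      (fun i h1 h2 => hF.subsingleton_ext (hWF _ hw) hm i h1 (by lia)) i h1 (by lia))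

lemma prop_endTensor_obj (hW : W.IsClosedUnderIsomorphisms)
    (hcounit : ∀ w, W w → IsIso ((endAdj s).counit.app w))
    {g : ModuleCat.{u} (Module.End R s)ᵐᵒᵖ} (hg : W.map (endHom s) g) :
    W ((endTensor s).obj g) := by
  obtain ⟨w, hw, ⟨e⟩⟩ := hg
  have := hcounit w hw
  exact W.prop_of_iso ((asIso ((endAdj s).counit.app w)).symm ≪≫ (endTensor s).mapIso e) hw

lemma isEquivalence_lift_endTensor
    (hcounit : ∀ w, W w → IsIso ((endAdj s).counit.app w))
    (h : ∀ g : (W.map (endHom s)).FullSubcategory, W ((endTensor s).obj g.obj)) :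
    (W.lift (ObjectProperty.ι _ ⋙ endTensor s) h).IsEquivalence := by
  have hunit : ∀ g : (W.map (endHom s)).FullSubcategory, IsIso ((endAdj s).unit.app g.obj) := by
    rintro ⟨g, w, hw, ⟨e⟩⟩
    exact isIso_unit_of_iso (endAdj s) e (hcounit w hw)
  refine { faithful := ⟨fun {g g'} a b hab => ObjectProperty.hom_ext _ ?_⟩,
           full := ⟨fun {g g'} α => ?_⟩, essSurj := ⟨fun w => ?_⟩ }
  · exact map_injective_of_isIso_unit (endAdj s) (hunit g') (congrArg (·.hom) hab)
  · obtain ⟨a, ha⟩ := exists_map_eq_of_isIso_unit (endAdj s) (hunit g') α.hom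
    exact ⟨ObjectProperty.homMk a, ObjectProperty.hom_ext _ ha⟩
  · have := hcounit w.obj w.property
    exact ⟨⟨(endHom s).obj w.obj, W.prop_map_obj _ w.property⟩,
      ⟨W.isoMk (asIso ((endAdj s).counit.app w.obj))⟩⟩

end Transport

/-! ### Wideness -/

section Wide

variable {R : Type u} [Ring R] {s : ModuleCat.{u} R} {k : ℕ}
  {F W : ObjectProperty (ModuleCat.{u} R)}

/-- An isomorphism of arrows in the ambient category lifts to a full subcategory. -/
lemma nonempty_arrow_iso_of_hom {C : Type*} [Category* C] {P : ObjectProperty C}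
    {X Y X' Y' : P.FullSubcategory} {u : X ⟶ Y} {v : X' ⟶ Y'}
    (e : Arrow.mk u.hom ≅ Arrow.mk v.hom) : Nonempty (Arrow.mk u ≅ Arrow.mk v) :=
  ⟨Arrow.isoMk (P.isoMk (Arrow.leftFunc.mapIso e)) (P.isoMk (Arrow.rightFunc.mapIso e))
    (P.hom_ext e.hom.w)⟩

/-- If `g` is isomorphic to `Hom_R(s, f)`, then `g ⊗ s` is isomorphic to `f`. -/
lemma nonempty_arrow_iso_endTensor {X Y : ModuleCat.{u} R} {f : X ⟶ Y}
    (hX : IsIso ((endAdj s).counit.app X)) (hY : IsIso ((endAdj s).counit.app Y))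
    {M N : ModuleCat.{u} (Module.End R s)ᵐᵒᵖ} {g : M ⟶ N}
    (e : Arrow.mk g ≅ Arrow.mk ((endHom s).map f)) :
    Nonempty (Arrow.mk ((endTensor s).map g) ≅ Arrow.mk f) :=
  ⟨(endTensor s).mapArrow.mapIso e ≪≫
    Arrow.isoMk (f := Arrow.mk ((endTensor s).map ((endHom s).map f)))
      (asIso ((endAdj s).counit.app X)) (asIso ((endAdj s).counit.app Y))
      ((endAdj s).counit_naturality f).symm⟩

lemma isAdditiveSubcategory_inverseImage (hG : IsDClusterTilting (k + 1) (W.map (endHom s)))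
    (hWF : W ≤ F)
    (hW : W.IsClosedUnderIsomorphisms) (hcounit : ∀ w, W w → IsIso ((endAdj s).counit.app w))
    (hHF : ∀ m, F m → W.map (endHom s) ((endHom s).obj m)) :
    IsAdditiveSubcategory (W.inverseImage F.ι) where
  isClosedUnderIsomorphisms := inferInstance
  containsZero := by
    obtain ⟨Z, hZ⟩ := HasZeroObject.zero (C := ModuleCat.{u} (Module.End R s)ᵐᵒᵖ)
    have hz : IsZero ((endTensor s).obj Z) := (endTensor s).map_isZero hZ
    have hWz := prop_endTensor_obj hW hcounit (hG.of_isZero hZ)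
    exact ⟨⟨⟨_, hWF _ hWz⟩, IsZero.of_full_of_faithful_of_isZero F.ι _ hz, hWz⟩⟩
  directSum X Y hX hY := by
    have hWXY : W (X.obj ⊞ Y.obj) := by
      have h := prop_endTensor_obj hW hcounit
        (hG.biprod (W.prop_map_obj (endHom s) hX) (W.prop_map_obj (endHom s) hY))
      have := hcounit X.obj hX
      have := hcounit Y.obj hY
      have := preservesBinaryBiproducts_of_preservesBiproducts (endTensor s)
      exact W.prop_of_iso ((endTensor s).mapBiprod _ _ ≪≫
        biprod.mapIso (asIso ((endAdj s).counit.app X.obj)) (asIso ((endAdj s).counit.app Y.obj))) h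
    let b : BinaryBicone X Y :=
      { pt := ⟨X.obj ⊞ Y.obj, hWF _ hWXY⟩
        fst := ObjectProperty.homMk biprod.fst
        snd := ObjectProperty.homMk biprod.snd
        inl := ObjectProperty.homMk biprod.inl
        inr := ObjectProperty.homMk biprod.inr
        inl_fst := F.hom_ext biprod.inl_fst
        inl_snd := F.hom_ext biprod.inl_snd
        inr_fst := F.hom_ext biprod.inr_fst
        inr_snd := F.hom_ext biprod.inr_snd }
    exact ⟨b, ⟨isBinaryBilimitOfTotal b (F.hom_ext biprod.total)⟩, hWXY⟩
  summand X Y r hY := by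
    let r' : Retract X.obj Y.obj := r.map F.ι
    have := hcounit Y.obj hY
    have : IsIso ((endAdj s).counit.app X.obj) :=
      isIso_app_of_sum (ι := Unit) (endAdj s).counit (f := fun _ => r'.i) (g := fun _ => r'.r)
        (by simp)
    exact W.prop_of_iso (asIso ((endAdj s).counit.app X.obj))
      (prop_endTensor_obj hW hcounit (hHF _ X.property))

/-- `Hom_R(s, -)` preserves the surjectivity of the last map of an exact sequence in `F` with
`Ext^i(s, -) = 0` on the left end for all `i ≥ 1`; the obstruction is shifted to `Ext^d` there. -/
lemma epi_endHom_map_last (hF : IsDClusterTilting (k + 1) F) (hs : F s)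
    {S : ComposableArrows (ModuleCat.{u} R) (k + 2)} (hS : S.Exact) (hmono : Mono (S.map' 0 1))
    (hepi : Epi (S.map' (k + 1) (k + 2))) (hSF : ∀ i, F (S.obj i))
    (hA : ∀ i, 1 ≤ i → Subsingleton (Abelian.Ext s (S.obj' 0) i)) :
    Epi ((endHom s).map (S.map' (k + 1) (k + 2))) := by
  have hK : Subsingleton (Abelian.Ext s (kernel (S.map' (k + 1) (k + 2))) 1) := by
    refine subsingleton_ext_kernel hS.δ₀ s (k + 1)
      (fun j hj i h1 h2 => hF.subsingleton_ext hs (hSF _) i h1 h2)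
      (fun _ i h1 h2 => ?_) k (by lia) 1 le_rfl (by lia)
    refine subsingleton_ext_X₃_right (shortExact_kernel_lift hS 0 (by lia)) s (hA i h1) ?_
    have hz : IsZero (kernel (S.map' 0 1)) := isZero_kernel_of_mono _
    exact subsingleton_ext_right_of_isZero hz s (i + 1)
  exact (shortExact_map_homFunctor (shortExact_kernel_of_epi _ hepi) hK).epi_g

/-- The elements of `Hom_R(s, X)` are the morphisms from `s`, so a `d`-kernel is exact under
`Hom_R(s, -)` by definition. -/
lemma exact_comp_endHom (hs : F s) {S : ComposableArrows F.FullSubcategory (k + 2)}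
    (hS : IsDKernel S) :
    ComposableArrows.Exact
      ((S ⋙ F.ι) ⋙ endHom s : ComposableArrows (ModuleCat.{u} (Module.End R s)ᵐᵒᵖ) (k + 2)) where
  zero i hi := by
    change (endHom s).map (S.map' i (i + 1)).hom ≫ (endHom s).map (S.map' (i + 1) (i + 2)).hom = 0
    have h : (S.map' i (i + 1)).hom ≫ (S.map' (i + 1) (i + 2)).hom = 0 :=
      (isComplex_of_isDKernel hS).zero i
    rw [← (endHom s).map_comp, h, (endHom s).map_zero]
  exact i hi := by
    rw [ShortComplex.moduleCat_exact_iff]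
    intro f hf
    obtain ⟨g, hg⟩ := exists_lift_of_isDKernel hS hs i hi
      (ModuleCat.ofHom (show s →ₗ[R] (S.obj' (i + 1)).obj from f)) (ModuleCat.hom_ext hf)
    exact ⟨(g.hom : s →ₗ[R] (S.obj' i).obj), congrArg ModuleCat.Hom.hom hg⟩

/-- Applying `Hom_R(s, -)` and then `- ⊗ s` to a `d`-exact sequence with ends in `W` gives a
sequence in `W`, and the counit is a morphism of extensions to the original sequence. -/
lemma exists_dExtension (hF : IsDClusterTilting (k + 1) F)
    (hinj : ∀ M, ModuleCat.isFG R M → ∃ (I : ModuleCat.{u} R) (f : M ⟶ I),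
      Mono f ∧ Injective I ∧ ModuleCat.isFG R I)
    (hWF : W ≤ F) (hW : W.IsClosedUnderIsomorphisms) (hs : W s)
    (hcounit : ∀ w, W w → IsIso ((endAdj s).counit.app w))
    (hextW : ∀ w, W w → ∀ i, 1 ≤ i → Subsingleton (Abelian.Ext s w i))
    (hHF : ∀ m, F m → W.map (endHom s) ((endHom s).obj m))
    (hT : (endTensor s).PreservesHomology)
    {A B : F.FullSubcategory} (S : DExtension (k + 1) A B) (hA : W A.obj) (hB : W B.obj) :
    ∃ T : DExtension (k + 1) A B, (∀ i, W (T.seq.obj i).obj) ∧ DExtension.YonedaEquiv S T := by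
  have hWobj : ∀ m, F m → W ((endTensor s).obj ((endHom s).obj m)) :=
    fun m hm => prop_endTensor_obj hW hcounit (hHF m hm)
  have hA' : W (S.seq.obj' 0).obj := W.prop_of_iso (F.ι.mapIso S.isoLeft).symm hA
  have hB' : W (S.seq.obj' (k + 2)).obj := W.prop_of_iso (F.ι.mapIso S.isoRight).symm hB
  let S₀ : ComposableArrows (ModuleCat.{u} R) (k + 2) := S.seq ⋙ F.ι
  have hS₀ : S₀.Exact := exact_of_isDKernel hF S.isDExact.isDKernel
  have hmono : Mono (S₀.map' 0 1) := mono_of_isDKernel hF S.isDExact.isDKernel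
  have hepi : Epi (S₀.map' (k + 1) (k + 2)) := epi_of_isDCokernel hF hinj S.isDExact.isDCokernel
  let T₀ : ComposableArrows (ModuleCat.{u} R) (k + 2) := (S₀ ⋙ endHom s) ⋙ endTensor s
  have hT₀ : T₀.Exact :=
    exact_comp_of_preservesHomology (exact_comp_endHom (hWF _ hs) S.isDExact.isDKernel) _
  have hTmono : Mono (T₀.map' 0 1) := by
    have : Mono ((endHom s).map (S₀.map' 0 1)) := inferInstance
    exact inferInstanceAs (Mono ((endTensor s).map ((endHom s).map (S₀.map' 0 1))))
  have hTepi : Epi (T₀.map' (k + 1) (k + 2)) := by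
    have := epi_endHom_map_last hF (hWF _ hs) hS₀ hmono hepi (fun i => (S.seq.obj i).property)
      (hextW _ hA')
    exact inferInstanceAs (Epi ((endTensor s).map ((endHom s).map (S₀.map' (k + 1) (k + 2)))))
  have hTW : ∀ i, W (T₀.obj i) := fun i => hWobj _ (S.seq.obj i).property
  let T₁ : ComposableArrows F.FullSubcategory (k + 2) := F.lift T₀ fun i => hWF _ (hTW i)
  let φ : T₁ ⟶ S.seq :=
    { app := fun i => ObjectProperty.homMk ((endAdj s).counit.app (S.seq.obj i).obj)
      naturality := fun i j f => F.hom_ext ((endAdj s).counit_naturality (S.seq.map f).hom) }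
  let A₀ : F.FullSubcategory := S.seq.obj' 0
  let B₀ : F.FullSubcategory := S.seq.obj' (k + 2)
  have : IsIso ((endAdj s).counit.app A₀.obj) := hcounit _ hA'
  have : IsIso ((endAdj s).counit.app B₀.obj) := hcounit _ hB'
  let T : DExtension (k + 1) A B :=
    { seq := T₁
      isDExact := ⟨hF.isDKernel_lift hT₀ hTmono _, hF.isDCokernel_lift hT₀ hTepi _⟩
      isoLeft := F.isoMk (asIso ((endAdj s).counit.app A₀.obj)) ≪≫ S.isoLeft
      isoRight := F.isoMk (asIso ((endAdj s).counit.app B₀.obj)) ≪≫ S.isoRight }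
  exact ⟨T, hTW, .symm _ _ (.rel _ _ ⟨φ, rfl, rfl⟩)⟩

end Wide

end HigherWide

theorem theoremB {k : Type*} [Field k] [IsAlgClosed k]
    {Φ : Type u} [Ring Φ] [Algebra k Φ] [Module.Finite k Φ]
    (d : ℕ) (hd : 1 ≤ d)
    (F : ObjectProperty (ModuleCat.{u} Φᵐᵒᵖ)) (hF : HigherWide.IsDClusterTilting d F)
    (W : ObjectProperty (ModuleCat.{u} Φᵐᵒᵖ)) (hWF : W ≤ F) (hW : W.IsClosedUnderIsomorphisms)
    (s : ModuleCat.{u} Φᵐᵒᵖ) (hs : W s)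
    (h_projdim : projectiveDimension s < ⊤)
    (h_ext : ∀ i : ℕ, 1 ≤ i → Subsingleton (Abelian.Ext s s i))
    (h_res : ∀ w, W w → HigherWide.HasFiniteResolution (HigherWide.addSubcategory s) w)
    (h_tilting : HigherWide.IsDClusterTilting d
      (W.map (HigherWide.homFunctor (Module.End Φᵐᵒᵖ s) Φᵐᵒᵖ s))) :
    HigherWide.IsWide d (W.inverseImage F.ι) ∧
    ∃ h : ∀ g : (W.map (HigherWide.homFunctor (Module.End Φᵐᵒᵖ s) Φᵐᵒᵖ s)).FullSubcategory,
        W ((HigherWide.tensorFunctor (Module.End Φᵐᵒᵖ s) Φᵐᵒᵖ s).obj g.obj),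
      (W.lift (ObjectProperty.ι _ ⋙ HigherWide.tensorFunctor (Module.End Φᵐᵒᵖ s) Φᵐᵒᵖ s)
        h).IsEquivalence := by
  obtain ⟨k', rfl⟩ := Nat.exists_eq_add_of_le' hd
  have : Module.Finite k Φᵐᵒᵖ := Module.Finite.equiv (MulOpposite.opLinearEquiv k)
  have : IsNoetherianRing Φᵐᵒᵖ := IsNoetherianRing.of_finite k Φᵐᵒᵖ
  have hsfg : ModuleCat.isFG Φᵐᵒᵖ s := hF.le_isFG _ (hWF _ hs)
  obtain ⟨_, _, hscalar⟩ := HigherWide.exists_algebra_end k s hsfg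
  have : IsNoetherianRing (Module.End Φᵐᵒᵖ s)ᵐᵒᵖ := IsNoetherianRing.of_finite k _
  have hres : ∀ w, W w → HigherWide.FinitelyResolved s w := fun w hw =>
    .of_hasFiniteResolution (h_res w hw)
  have hcounit : ∀ w, W w → IsIso ((HigherWide.endAdj s).counit.app w) := fun w hw =>
    (hres w hw).isIso_counit h_ext
  have hinjR := HigherWide.exists_mono_injective k (A := Φᵐᵒᵖ)
  have hinjΓ := HigherWide.exists_mono_injective k (A := (Module.End Φᵐᵒᵖ s)ᵐᵒᵖ)
  have hT := HigherWide.preservesHomology_endTensor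
    (HigherWide.injective_endHom_obj h_ext hres h_tilting hinjΓ)
  have hHF : ∀ m, F m → W.map (HigherWide.endHom s) ((HigherWide.endHom s).obj m) := fun m hm =>
    HigherWide.prop_endHom_obj h_ext hres h_tilting hF hWF hs
      (fun X hX => HigherWide.isFG_homFunctor hsfg hscalar hX) hm
  have hTW : ∀ g, W.map (HigherWide.endHom s) g → W ((HigherWide.endTensor s).obj g) :=
    fun g hg => HigherWide.prop_endTensor_obj hW hcounit hg
  refine ⟨⟨HigherWide.isAdditiveSubcategory_inverseImage h_tilting hWF hW hcounit hHF,
    fun {X Y} f hX hY => ?_, fun {X Y} f hX hY => ?_, fun {A B} S hA hB => ?_⟩,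
    fun g => hTW _ g.property, HigherWide.isEquivalence_lift_endTensor hcounit _⟩
  · obtain ⟨S, hS, hmono, hSG, ⟨e⟩⟩ := h_tilting.exists_exact_of_hom_right
      ((HigherWide.endHom s).map f.hom) (W.prop_map_obj _ hX) (W.prop_map_obj _ hY)
    obtain ⟨e'⟩ := HigherWide.nonempty_arrow_iso_endTensor (hcounit _ hX) (hcounit _ hY) e
    exact ⟨_, hF.isDKernel_lift
      (HigherWide.exact_comp_of_preservesHomology hS (HigherWide.endTensor s))
      (inferInstanceAs (Mono ((HigherWide.endTensor s).map (S.map' 0 1))))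
      (fun i => hWF _ (hTW _ (hSG i))), fun i => hTW _ (hSG i),
      HigherWide.nonempty_arrow_iso_of_hom e'⟩
  · obtain ⟨S, hS, hepi, hSG, ⟨e⟩⟩ := h_tilting.exists_exact_of_hom_left hinjΓ
      ((HigherWide.endHom s).map f.hom) (W.prop_map_obj _ hX) (W.prop_map_obj _ hY)
    obtain ⟨e'⟩ := HigherWide.nonempty_arrow_iso_endTensor (hcounit _ hX) (hcounit _ hY) e
    exact ⟨_, hF.isDCokernel_lift
      (HigherWide.exact_comp_of_preservesHomology hS (HigherWide.endTensor s))
      (inferInstanceAs (Epi ((HigherWide.endTensor s).map (S.map' (k' + 1) (k' + 2)))))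
      (fun i => hWF _ (hTW _ (hSG i))), fun i => hTW _ (hSG i),
      HigherWide.nonempty_arrow_iso_of_hom e'⟩
  · exact HigherWide.exists_dExtension hF hinjR hWF hW hs hcounit
      (fun w hw => (hres w hw).subsingleton_ext h_ext) hHF hT S hA hB
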